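/- Let $f:\mathbb R^n\to\mathbb R\cup\{+\infty\}$ be an $(M,\nu)$-generalized self-concordant function with $\nu\ge 2$, i.e. $\operatorname{dom} f=\{x: f(x)<+\infty\}$ is open, $f$ is closed and convex, $f\in C^3(\operatorname{dom} f)$, and $$|\langle D^3f(x)[w]u,u\rangle|\le M\,\|u\|_{\nabla^2 f(x)}^2\,\|w\|_{\nabla^2 f(x)}^{\nu-2}\,\|w\|_2^{3-\nu}\qquad(x\in\operatorname{dom} f,\ u,w\in\mathbb R^n),$$ where $\|u\|_{\nabla^2f(x)}^2=\langle\nabla^2f(x)u,u\rangle$. Assume that $\operatorname{dom} f$ contains no straight line. Let $X\subset\mathbb R^n$ be a polytope with vertex set $V$ and diameter $D$, let $x_0\in V\cap\operatorname{dom} f$, let $x^*$ be a minimizer of $f$ over $X$, and put $h(x)=f(x)-f(x^*)$. Let $\tau>1$ and $L_{-1}>0$. **Algorithm (Away-step Frank-Wolfe with backtracking).** Start with the active set $S_0=\{x_0\}$ and weight $\lambda_0(x_0)=1$. At iteration $t=0,1,\dots$ choose a vertex $v_t\in V$ minimizing $\langle\nabla f(x_t),\cdot\rangle$ over $X$ and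 $a_t\in S_t$ maximizing $\langle\nabla f(x_t),\cdot\rangle$ over $S_t$. If $\langle\nabla f(x_t),x_t-v_t\rangle\ge\langle\nabla f(x_t),a_t-x_t\rangle$, put $d_t=v_t-x_t$, $\gamma_{\max}=1$; otherwise put $d_t=x_t-a_t$, $\gamma_{\max}=\lambda_t(a_t)/(1-\lambda_t(a_t))$. *Backtracking:* choose $\eta\in(0,1]$ and $m\in[\eta L_{t-1},L_{t-1}]$, set $\gamma=\min\{-\langle\nabla f(x_t),d_t\rangle/(m\|d_t\|^2),\gamma_{\max}\}$ ($\gamma=0$ if $d_t=0$), and while $x_t+\gamma d_t\notin\operatorname{dom} f$ or $f(x_t+\gamma d_t)-f(x_t)>\frac{m\gamma^2}{2}\|d_t\|^2+\gamma\langle\nabla f(x_t),d_t\rangle$, replace $m$ by $\tau m$ and recompute $\gamma$; on exit set $\gamma_t=\gamma$, $L_t=m$. Put $x_{t+1}=x_t+\gamma_td_t$. The weights become $\lambda_{t+1}=(1-\gamma_t)\lambda_t+\gamma_t\mathbf 1_{v_t}$ in the first case and $\lambda_{t+1}=(1+\gamma_t)\lambda_t-\gamma_t\mathbf 1_{a_t}$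 in the second, and $S_{t+1}$ is the support of $\lambda_{t+1}$. **Constants.** Let $\mathcal L_0=\{x\in X\cap\operatorname{dom} f: f(x)\le f(x_0)\}$, and let $L_f^{\mathcal L_0}$ and $\mu_f^{\mathcal L_0}$ be the maximum and the minimum of $\|d\|^2_{\nabla^2f(u)}/\|d\|_2^2$ over $u\in\mathcal L_0$, $d\ne0$. Let $\tilde L=\max\{\tau L_f^{\mathcal L_0},L_{-1}\}$. Let $\delta$ be the pyramidal width of $X$: the infimum, over all faces $K$ of $X$ ($X$ included), $x\in K$ and $0\ne r\in\operatorname{cone}(K-x)$, of $$\min_{S}\ \max_{s\in K\cap V,\ v\in S}\Big\langle \frac{r}{\|r\|},s-v\Big\rangle,$$ where $S$ runs over the subsets of $K\cap V$ of which $x$ is a convex combination with all weights positive. **Theorem.** The algorithm can always be continued, i.e. after any number of iterations a further iteration, with a terminating line search, exists; all iterates lie in $X\cap\operatorname{dom} f$, and for every run and every $t\ge0$ $$h(x_t)\le h(x_0)\left(1-\frac{\mu_f^{\mathcal L_0}}{4\tilde L}\Big(\frac{\delta}{D}\Big)^2\right)^{\lceil (t-1)/2\rceil}.$$ If $X$ has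 at least two points, then $\mu_f^{\mathcal L_0}>0$ and $\delta>0$, so that the convergence is linear. (If $X$ is a single point, then $h(x_t)=h(x_0)=0$ and the bound reads $0\le 0$.) -/

import Mathlib

namespace AwayFW

noncomputable section

/-- The Euclidean space `ℝⁿ`. -/
abbrev Vec (n : ℕ) : Type := EuclideanSpace ℝ (Fin n)

/-! ### Extended-valued functions and generalized self-concordance -/

/-- The (effective) domain `{x | f x < +∞}` of `f : ℝⁿ → ℝ ∪ {+∞}`. -/
def dom {n : ℕ} (f : Vec n → WithTop ℝ) : Set (Vec n) := {x | f x < ⊤}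

/-- The real value of `f` at a point of its domain (and `0` outside of the domain). -/
def val {n : ℕ} (f : Vec n → WithTop ℝ) (x : Vec n) : ℝ := (f x).untopD 0

/-- The epigraph of `f`. -/
def epigraph {n : ℕ} (f : Vec n → WithTop ℝ) : Set (Vec n × ℝ) := {p | f p.1 ≤ (p.2 : WithTop ℝ)}

/-- The gradient of `f` (meaningful on the domain when that is open). -/
def grad {n : ℕ} (f : Vec n → WithTop ℝ) (x : Vec n) : Vec n := gradient (val f) x

/-- The Hessian of `f` at `x` as a bilinear form: `hess f x u w = ⟨∇²f(x) u, w⟩`. -/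
def hess {n : ℕ} (f : Vec n → WithTop ℝ) (x u w : Vec n) : ℝ :=
  fderiv ℝ (fderiv ℝ (val f)) x u w

/-- `third f x w u = ⟨D³f(x)[w] u, u⟩`: the derivative of the Hessian at `x` in direction `w`,
evaluated as a quadratic form at `u`. -/
def third {n : ℕ} (f : Vec n → WithTop ℝ) (x w u : Vec n) : ℝ :=
  fderiv ℝ (fderiv ℝ (fderiv ℝ (val f))) x w u u

/-- `‖u‖` in the (semi)norm of the Hessian of `f` at `x`. -/
def hessNorm {n : ℕ} (f : Vec n → WithTop ℝ) (x u : Vec n) : ℝ := Real.sqrt (hess f x u u)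

/-- `f` is an `(M, ν)`-generalized self-concordant function. -/
structure IsGenSelfConcordant {n : ℕ} (M ν : ℝ) (f : Vec n → WithTop ℝ) : Prop where
  isOpen_dom : IsOpen (dom f)
  contDiffOn : ContDiffOn ℝ 3 (val f) (dom f)
  closed : IsClosed (epigraph f)
  convex : Convex ℝ (epigraph f)
  bound : ∀ x ∈ dom f, ∀ u w : Vec n,
    |third f x w u| ≤ M * hessNorm f x u ^ 2 * hessNorm f x w ^ (ν - 2) * ‖w‖ ^ (3 - ν)

/-- The set `C` contains no straight line. -/
def ContainsNoLine {n : ℕ} (C : Set (Vec n)) : Prop :=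
  ∀ x d : Vec n, d ≠ 0 → ∃ s : ℝ, x + s • d ∉ C

/-- `L_f^C`, the largest value of `‖d‖²_{∇²f(u)} / ‖d‖²` over `u ∈ C` and `d ≠ 0`. -/
def smoothConst {n : ℕ} (f : Vec n → WithTop ℝ) (C : Set (Vec n)) : ℝ :=
  sSup {q : ℝ | ∃ u ∈ C, ∃ d : Vec n, d ≠ 0 ∧ q = hessNorm f u d ^ 2 / ‖d‖ ^ 2}

/-- `μ_f^C`, the smallest value of `‖d‖²_{∇²f(u)} / ‖d‖²` over `u ∈ C` and `d ≠ 0`. -/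
def strongConst {n : ℕ} (f : Vec n → WithTop ℝ) (C : Set (Vec n)) : ℝ :=
  sInf {q : ℝ | ∃ u ∈ C, ∃ d : Vec n, d ≠ 0 ∧ q = hessNorm f u d ^ 2 / ‖d‖ ^ 2}

/-- The initial sublevel set `{x ∈ dom f ∩ X | f x ≤ f x₀}`. -/
def initialLevel {n : ℕ} (f : Vec n → WithTop ℝ) (X : Set (Vec n)) (x₀ : Vec n) : Set (Vec n) :=
  {x | x ∈ dom f ∧ x ∈ X ∧ f x ≤ f x₀}

/-! ### Polytopes and the pyramidal width -/

/-- A polytope: the convex hull of finitely many points. -/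
def IsPolytope {n : ℕ} (X : Set (Vec n)) : Prop :=
  ∃ F : Set (Vec n), F.Finite ∧ X = convexHull ℝ F

/-- The vertices of `X`. -/
abbrev vertices {n : ℕ} (X : Set (Vec n)) : Set (Vec n) := X.extremePoints ℝ

/-- `x` is a convex combination of all the points of `S`, each with a positive weight. -/
def IsProperCombination {n : ℕ} (S : Finset (Vec n)) (x : Vec n) : Prop :=
  ∃ w : Vec n → ℝ, (∀ v ∈ S, 0 < w v) ∧ ∑ v ∈ S, w v = 1 ∧ ∑ v ∈ S, w v • v = x

/-- The pyramidal directional width of a finite set `A` in direction `r` with base point `x`: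
the minimum, over all `S ⊆ A` of which `x` is a proper convex combination, of
`max_{s ∈ A, v ∈ S} ⟨r / ‖r‖, s - v⟩`. -/
def pyramidalDirWidth {n : ℕ} (A : Set (Vec n)) (r x : Vec n) : ℝ :=
  sInf {m : ℝ | ∃ S : Finset (Vec n), (S : Set (Vec n)) ⊆ A ∧ IsProperCombination S x ∧
    m = sSup {c : ℝ | ∃ s ∈ A, ∃ v ∈ S, c = inner ℝ (‖r‖⁻¹ • r) (s - v)}}

/-- `cone (K - x)` for a convex set `K` containing `x`: the directions feasible from `x`. -/
def feasibleCone {n : ℕ} (K : Set (Vec n)) (x : Vec n) : Set (Vec n) :=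
  {r | ∃ c : ℝ, 0 ≤ c ∧ ∃ y ∈ K, r = c • (y - x)}

/-- The pyramidal width of the polytope `X`: the minimum of the pyramidal directional widths of
the vertex sets of its faces `K` (the polytope `X` itself included), over all base points `x ∈ K`
and all nonzero directions `r ∈ cone (K - x)`. -/
def pyramidalWidth {n : ℕ} (X : Set (Vec n)) : ℝ :=
  sInf {m : ℝ | ∃ K : Set (Vec n), IsExposed ℝ X K ∧ ∃ x ∈ K, ∃ r ∈ feasibleCone K x,
    r ≠ 0 ∧ m = pyramidalDirWidth (K ∩ vertices X) r x}

/-! ### The Away-step Frank-Wolfe algorithm with backtracking -/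

/-- The step size `min {-⟨∇f(x), d⟩ / (M ‖d‖²), γmax}` tried by the line search for the
smoothness estimate `M`. -/
def trialStep {n : ℕ} (f : Vec n → WithTop ℝ) (x d : Vec n) (γmax M : ℝ) : ℝ :=
  min (-inner ℝ (grad f x) d / (M * ‖d‖ ^ 2)) γmax

/-- The acceptance test of the line search for the smoothness estimate `M`: the negation of the
condition of its while-loop. -/
def Accepts {n : ℕ} (f : Vec n → WithTop ℝ) (x d : Vec n) (γmax M : ℝ) : Prop :=
  x + trialStep f x d γmax M • d ∈ dom f ∧
    val f (x + trialStep f x d γmax M • d) - val f x ≤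
      M * trialStep f x d γmax M ^ 2 / 2 * ‖d‖ ^ 2 +
        trialStep f x d γmax M * inner ℝ (grad f x) d

/-- `IsBacktrack τ f x d L γmax γ L'`: the call `Backtrack (f, x, d, L, γmax)` with backtracking
parameter `τ` can return the step size `γ` and the smoothness estimate `L'`. The line search
starts with any estimate `m ∈ [η L, L]`, where `0 < η ≤ 1`, and multiplies it by `τ` until the test
is passed for the first time, here after `k` multiplications. -/
def IsBacktrack {n : ℕ} (τ : ℝ) (f : Vec n → WithTop ℝ) (x d : Vec n) (L γmax γ L' : ℝ) : Prop :=
  ∃ η m : ℝ, 0 < η ∧ η ≤ 1 ∧ m ∈ Set.Icc (η * L) L ∧ ∃ k : ℕ,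
    (∀ j < k, ¬ Accepts f x d γmax (τ ^ j * m)) ∧ Accepts f x d γmax (τ ^ k * m) ∧
      L' = τ ^ k * m ∧ γ = trialStep f x d γmax L'

/-- The state of the algorithm before an iteration: the iterate `x_t`, the weights `λ_t`, whose
support is the active set `S_t`, and the current smoothness estimate `L_{t-1}`. -/
structure State (n : ℕ) where
  point : Vec n
  weights : Vec n →₀ ℝ
  estimate : ℝ

/-- The initial state: active set `{x₀}`, with weight `1`, and estimate `L_{-1}`. -/
def initialState {n : ℕ} (x₀ : Vec n) (Linit : ℝ) : State n := ⟨x₀, Finsupp.single x₀ 1, Linit⟩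

/-- One iteration of the Away-step Frank-Wolfe algorithm with backtracking line search leads from
the state `s` to the state `s'`. Here `v` is the vertex returned by the linear minimization oracle,
`a` the away vertex, chosen from the active set, and `γ` the step size. After a Frank-Wolfe step
`x ↦ x + γ (v - x)` all weights are multiplied by `1 - γ` and `γ` is added to that of `v`; after an
away step `x ↦ x + γ (x - a)` they are multiplied by `1 + γ` and `γ` is subtracted from that
of `a`. -/
def Step {n : ℕ} (τ : ℝ) (f : Vec n → WithTop ℝ) (X : Set (Vec n)) (s s' : State n) : Prop :=
  ∃ v a : Vec n, ∃ γ : ℝ,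
    v ∈ vertices X ∧ (∀ y ∈ X, inner ℝ (grad f s.point) v ≤ inner ℝ (grad f s.point) y) ∧
    a ∈ s.weights.support ∧
    (∀ y ∈ s.weights.support, inner ℝ (grad f s.point) y ≤ inner ℝ (grad f s.point) a) ∧
    ((inner ℝ (grad f s.point) (a - s.point) ≤ inner ℝ (grad f s.point) (s.point - v) ∧
        IsBacktrack τ f s.point (v - s.point) s.estimate 1 γ s'.estimate ∧
        s'.point = s.point + γ • (v - s.point) ∧
        s'.weights = (1 - γ) • s.weights + Finsupp.single v γ) ∨
      (inner ℝ (grad f s.point) (s.point - v) < inner ℝ (grad f s.point) (a - s.point) ∧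
        IsBacktrack τ f s.point (s.point - a) s.estimate
          (s.weights a / (1 - s.weights a)) γ s'.estimate ∧
        s'.point = s.point + γ • (s.point - a) ∧
        s'.weights = (1 + γ) • s.weights - Finsupp.single a γ))

/-- `s 0, …, s t` are the states of the algorithm, started at `x₀` with the smoothness estimate
`L_{-1} = Linit`, during its first `t` iterations. -/
def IsRun {n : ℕ} (τ : ℝ) (f : Vec n → WithTop ℝ) (X : Set (Vec n)) (x₀ : Vec n) (Linit : ℝ)
    (t : ℕ) (s : ℕ → State n) : Prop :=
  s 0 = initialState x₀ Linit ∧ ∀ i < t, Step τ f X (s i) (s (i + 1))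

/-- The primal gap `h(x) = f(x) - f(x⋆)`. -/
def primalGap {n : ℕ} (f : Vec n → WithTop ℝ) (xstar x : Vec n) : ℝ := val f x - val f xstar

end

end AwayFW

/-! The rate combines a curvature bound on the initial level set, a geometric bound on the polytope
and a count of the steps that may fail to contract the gap.

Curvature. If the Hessian degenerates in a direction `d`, the self-concordance bound for `u = w = d`
is a linear differential inequality for the Hessian form along the line, which forces it to stay
zero. Then `f` is affine on that line within its domain, and closedness of the epigraph puts the
whole line in the domain, which is excluded (`hess_pos`). As the initial level set is compact, its
strong convexity constant μ is positive and its smoothness constant L finite. A line search with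
estimate at least L never leaves the level set (`accepts_of_smoothConst_le`), so all estimates stay
below `max (τ * L) Linit`.

Geometry. Let g be the gradient at x, v and a the Frank-Wolfe and away vertices, h the primal gap
and G the larger of the two directional gaps, so that ⟨g, a - v⟩ ≤ 2G. Projecting -g onto the cone
of feasible directions and passing to the face that the residual exposes gives δ⟨g, x - x⋆⟩ ≤ 2G‖x⋆
- x‖ (`pyramidalWidth_mul_inner_le`). With strong convexity this yields δ²μh ≤ 2G²
(`width_sq_mul_primalGap_le`).

Progress. A step not cut off at its maximal length has γ = G/(m‖d‖²) and decreases `f` by at least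
γG/2, hence by the fraction `contraction` of h. A full Frank-Wolfe step halves h, which is better. A
maximal away step only guarantees that h does not grow, but it deletes an active vertex. Every other
step adds at most one vertex, so such drops make up at most half of the iterations (`step_progress`,
`run_progress`). -/

namespace AwayFW

/-! ### Finitely generated cones -/

section Cones

variable {ι E : Type*}

/-- The convex cone generated by the vectors `u i`, `i ∈ I`. -/
def genCone [AddCommGroup E] [Module ℝ E] (I : Finset ι) (u : ι → E) : Set E :=
  {r | ∃ w : ι → ℝ, (∀ i ∈ I, 0 ≤ w i) ∧ ∑ i ∈ I, w i • u i = r}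

theorem smul_mem_genCone [AddCommGroup E] [Module ℝ E] {I : Finset ι} {u : ι → E} {r : E}
    (hr : r ∈ genCone I u) {c : ℝ} (hc : 0 ≤ c) : c • r ∈ genCone I u := by
  obtain ⟨w, hw, rfl⟩ := hr
  exact ⟨fun i => c * w i, fun i hi => mul_nonneg hc (hw i hi), by
    simp [Finset.smul_sum, smul_smul]⟩

theorem convex_genCone [AddCommGroup E] [Module ℝ E] (I : Finset ι) (u : ι → E) :
    Convex ℝ (genCone I u) := by
  rintro _ ⟨w, hw, rfl⟩ _ ⟨w', hw', rfl⟩ a b ha hb -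
  exact ⟨fun i => a * w i + b * w' i,
    fun i hi => add_nonneg (mul_nonneg ha (hw i hi)) (mul_nonneg hb (hw' i hi)), by
      simp [Finset.smul_sum, smul_smul, add_smul, Finset.sum_add_distrib]⟩

/-- Carathéodory's theorem for cones: one generator of a linearly dependent family may be
dropped. -/
theorem genCone_eq_biUnion_erase [AddCommGroup E] [Module ℝ E] [DecidableEq ι] {I : Finset ι}
    {u : ι → E} (h : ¬ LinearIndepOn ℝ u (I : Set ι)) :
    genCone I u = ⋃ i ∈ I, genCone (I.erase i) u := by
  apply Set.Subset.antisymm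
  · rintro _ ⟨w, hw, rfl⟩
    rw [linearIndepOn_finset_iff] at h
    push Not at h
    obtain ⟨g₀, hg₀, i₁, hi₁, hne⟩ := h
    obtain ⟨g, hg, i₁, hi₁, hpos⟩ : ∃ g : ι → ℝ, ∑ i ∈ I, g i • u i = 0 ∧ ∃ i ∈ I, 0 < g i := by
      rcases lt_or_gt_of_ne hne with hlt | hgt
      · exact ⟨fun i => -g₀ i, by simp [hg₀], i₁, hi₁, by simpa using hlt⟩
      · exact ⟨g₀, hg₀, i₁, hi₁, hgt⟩
    -- Subtracting the smallest ratio `w i / g i` over positive `g i`, times `g`, keeps all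
    -- coefficients nonnegative and annihilates that of `i₀`.
    obtain ⟨i₀, hi₀, hle⟩ := Finset.exists_min_image (I.filter fun i => 0 < g i)
      (fun i => w i / g i) ⟨i₁, by simp [hi₁, hpos]⟩
    obtain ⟨hi₀I, hgi₀⟩ := Finset.mem_filter.1 hi₀
    refine Set.mem_biUnion hi₀I ⟨fun i => w i - w i₀ / g i₀ * g i, fun i hi => ?_, ?_⟩
    · have hiI := Finset.mem_of_mem_erase hi
      rw [sub_nonneg]
      by_cases hgi : 0 < g i
      · exact (le_div_iff₀ hgi).1 (hle i (Finset.mem_filter.2 ⟨hiI, hgi⟩))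
      · exact (mul_nonpos_of_nonneg_of_nonpos (div_nonneg (hw i₀ hi₀I) hgi₀.le)
          (not_lt.1 hgi)).trans (hw i hiI)
    · rw [Finset.sum_erase _ (by simp [hgi₀.ne'])]
      simp [sub_smul, mul_smul, Finset.sum_sub_distrib, ← Finset.smul_sum, hg]
  · intro r hr
    simp only [Set.mem_iUnion] at hr
    obtain ⟨i, hi, w, hw, rfl⟩ := hr
    refine ⟨fun j => if j = i then 0 else w j, fun j hj => ?_, ?_⟩
    · by_cases hji : j = i
      · simp [hji]
      · simpa [hji] using hw j (Finset.mem_erase.2 ⟨hji, hj⟩)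
    · rw [← Finset.sum_erase I (a := i) (by simp)]
      exact Finset.sum_congr rfl fun j hj => by simp [Finset.ne_of_mem_erase hj]

/-- Independent generators embed the closed orthant as a closed set; otherwise Carathéodory writes
the cone as a finite union of cones with fewer generators. -/
theorem isClosed_genCone [NormedAddCommGroup E] [NormedSpace ℝ E] [FiniteDimensional ℝ E]
    (I : Finset ι) (u : ι → E) : IsClosed (genCone I u) := by
  classical
  induction I using Finset.strongInduction with
  | H I ih =>
    by_cases h : LinearIndepOn ℝ u (I : Set ι)
    · have hemb := LinearMap.isClosedEmbedding_of_injective (𝕜 := ℝ)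
        (f := Fintype.linearCombination ℝ (fun i : I => u i))
        (LinearMap.ker_eq_bot.2 (LinearIndependent.fintypeLinearCombination_injective h))
      have hcl : IsClosed {w : I → ℝ | ∀ i, 0 ≤ w i} := by
        simp only [Set.ofPred_forall]
        exact isClosed_iInter fun i => isClosed_le continuous_const (continuous_apply i)
      convert hemb.isClosedMap _ hcl using 1
      ext r
      constructor
      · rintro ⟨w, hw, rfl⟩
        refine ⟨fun i => w i, fun i => hw i i.2, ?_⟩
        rw [Fintype.linearCombination_apply]
        exact Finset.sum_coe_sort I fun i => w i • u i
      · rintro ⟨w, hw, rfl⟩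
        refine ⟨fun i => if hi : i ∈ I then w ⟨i, hi⟩ else 0, fun i hi => ?_, ?_⟩
        · simpa [hi] using hw ⟨i, hi⟩
        · rw [Fintype.linearCombination_apply, ← Finset.sum_coe_sort I]
          exact Finset.sum_congr rfl fun i _ => by simp
    · rw [genCone_eq_biUnion_erase h]
      exact I.finite_toSet.isClosed_biUnion fun i hi => ih _ (Finset.erase_ssubset hi)

variable [NormedAddCommGroup E] [InnerProductSpace ℝ E] [FiniteDimensional ℝ E]

/-- Moreau decomposition with respect to a closed convex cone. -/
theorem exists_cone_projection {C : Set E} (hC : IsClosed C) (hconv : Convex ℝ C)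
    (h0 : (0 : E) ∈ C) (hsmul : ∀ x ∈ C, ∀ c : ℝ, 0 ≤ c → c • x ∈ C) (r : E) :
    ∃ p ∈ C, inner ℝ (r - p) p = 0 ∧ ∀ y ∈ C, inner ℝ (r - p) y ≤ 0 := by
  obtain ⟨p, hp, hpr⟩ := exists_norm_eq_iInf_of_complete_convex ⟨0, h0⟩ hC.isComplete hconv r
  -- Testing the variational inequality at `0` and at `2 • p` gives both signs of `⟨r - p, p⟩`.
  rw [norm_eq_iInf_iff_real_inner_le_zero hconv hp] at hpr
  have h1 := hpr 0 h0
  have h2 := hpr _ (hsmul p hp 2 zero_le_two)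
  rw [two_smul, add_sub_cancel_right] at h2
  rw [zero_sub, inner_neg_right] at h1
  have h3 : inner ℝ (r - p) p = 0 := le_antisymm h2 (by linarith)
  refine ⟨p, hp, h3, fun y hy => ?_⟩
  have := hpr y hy
  rwa [inner_sub_right, h3, sub_zero] at this

/-- The vectors of a finitely generated cone make a uniformly positive angle with one of the
generators. -/
theorem exists_pos_mul_norm_le_inner (I : Finset ι) (u : ι → E) :
    ∃ ε : ℝ, 0 < ε ∧ ∀ r ∈ genCone I u, r ≠ 0 → ∃ i ∈ I, ε * ‖r‖ ≤ inner ℝ r (u i) := by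
  classical
  rcases I.eq_empty_or_nonempty with rfl | hI
  · refine ⟨1, one_pos, ?_⟩
    rintro _ ⟨w, -, rfl⟩ hr
    simp at hr
  have hK : IsCompact (Metric.sphere (0 : E) 1 ∩ genCone I u) :=
    (isCompact_sphere 0 1).inter_right (isClosed_genCone I u)
  -- If no generator had positive product with `r`, the combination representing `r` would give `⟨r,
  -- r⟩ ≤ 0`.
  have hpos : ∀ r ∈ genCone I u, r ≠ 0 → ∃ i ∈ I, 0 < inner ℝ r (u i) := by
    rintro r ⟨w, hw, hwr⟩ hr
    by_contra! hcon
    have : inner ℝ r (∑ i ∈ I, w i • u i) ≤ (0 : ℝ) := by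
      rw [inner_sum]
      refine Finset.sum_nonpos fun i hi => ?_
      rw [real_inner_smul_right]
      exact mul_nonpos_of_nonneg_of_nonpos (hw i hi) (hcon i hi)
    rw [hwr] at this
    exact hr (real_inner_self_nonpos.1 this)
  have hnorm : ∀ r ∈ genCone I u, r ≠ 0 →
      ‖r‖⁻¹ • r ∈ Metric.sphere (0 : E) 1 ∩ genCone I u := fun r hr hr0 =>
    ⟨by simp [norm_smul, hr0], smul_mem_genCone hr (by positivity)⟩
  rcases (Metric.sphere (0 : E) 1 ∩ genCone I u).eq_empty_or_nonempty with he | hne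
  · refine ⟨1, one_pos, fun r hr hr0 => ?_⟩
    have := hnorm r hr hr0
    rw [he] at this
    exact this.elim
  obtain ⟨r₀, ⟨hr₀s, hr₀⟩, hmin⟩ := hK.exists_isMinOn hne
    (f := fun r => I.sup' hI fun i => inner ℝ r (u i))
    (Continuous.finset_sup'_apply hI fun i _ => by fun_prop).continuousOn
  refine ⟨I.sup' hI fun i => inner ℝ r₀ (u i), ?_, fun r hr hr0 => ?_⟩
  · obtain ⟨i, hi, hlt⟩ := hpos r₀ hr₀ (by rintro rfl; simp at hr₀s)
    exact (Finset.lt_sup'_iff hI).2 ⟨i, hi, hlt⟩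
  · have h := hmin (hnorm r hr hr0)
    obtain ⟨i, hi, hie⟩ := Finset.exists_mem_eq_sup' hI fun i => inner ℝ (‖r‖⁻¹ • r) (u i)
    refine ⟨i, hi, ?_⟩
    simp only [Set.mem_ofPred_eq] at h
    rw [hie, real_inner_smul_left] at h
    have hr' : 0 < ‖r‖ := norm_pos_iff.2 hr0
    calc _ ≤ (‖r‖⁻¹ * inner ℝ r (u i)) * ‖r‖ := by gcongr
      _ = _ := by field_simp

end Cones

/-! ### Polytopes and the pyramidal width -/

section Polytopes

variable {n : ℕ} {X : Set (Vec n)}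

theorem IsPolytope.isCompact (hX : IsPolytope X) : IsCompact X := by
  obtain ⟨F, hF, rfl⟩ := hX
  exact hF.isCompact_convexHull ℝ

theorem IsPolytope.convex (hX : IsPolytope X) : Convex ℝ X := by
  obtain ⟨F, -, rfl⟩ := hX
  exact convex_convexHull ℝ F

theorem IsPolytope.finite_vertices (hX : IsPolytope X) : (vertices X).Finite := by
  obtain ⟨F, hF, rfl⟩ := hX
  exact hF.subset extremePoints_convexHull_subset

theorem IsPolytope.convexHull_vertices (hX : IsPolytope X) : convexHull ℝ (vertices X) = X := by
  have h := closure_convexHull_extremePoints hX.isCompact hX.convex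
  rwa [(hX.finite_vertices.isCompact_convexHull ℝ).isClosed.closure_eq] at h

theorem IsProperCombination.nonempty {S : Finset (Vec n)} {x : Vec n}
    (h : IsProperCombination S x) : S.Nonempty := by
  obtain ⟨w, -, hw1, -⟩ := h
  by_contra hS
  simp [Finset.not_nonempty_iff_eq_empty.1 hS] at hw1

theorem IsPolytope.exists_isProperCombination (hX : IsPolytope X) {x : Vec n} (hx : x ∈ X) :
    ∃ S : Finset (Vec n), (S : Set (Vec n)) ⊆ vertices X ∧ IsProperCombination S x := by
  classical
  rw [← hX.convexHull_vertices, ← hX.finite_vertices.coe_toFinset, Finset.mem_convexHull'] at hx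
  obtain ⟨w, hw, hw1, hwx⟩ := hx
  refine ⟨hX.finite_vertices.toFinset.filter fun v => w v ≠ 0, fun v hv => ?_, w,
    fun v hv => ?_, ?_, ?_⟩
  · exact hX.finite_vertices.mem_toFinset.1 (Finset.mem_filter.1 hv).1
  · obtain ⟨h1, h2⟩ := Finset.mem_filter.1 hv
    exact (hw v h1).lt_of_ne' h2
  · rw [Finset.sum_filter_ne_zero, hw1]
  · rw [← hwx]
    refine Finset.sum_subset (Finset.filter_subset _ _) fun v hv hv' => ?_
    have : w v = 0 := by simpa [hv] using hv'
    simp [this]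

/-- The exposing functional is maximal at `x`, which averages its values on `S` with positive
weights; so each value is the maximum. -/
theorem IsProperCombination.subset_of_isExposed {K : Set (Vec n)} (hK : IsExposed ℝ X K)
    {x : Vec n} (hx : x ∈ K) {S : Finset (Vec n)} (hS : (S : Set (Vec n)) ⊆ X)
    (h : IsProperCombination S x) : (S : Set (Vec n)) ⊆ K := by
  obtain ⟨l, rfl⟩ := hK ⟨x, hx⟩
  obtain ⟨w, hw, hw1, hwx⟩ := h
  have hsum : ∑ v ∈ S, w v * (l x - l v) = 0 := by
    have h1 : ∑ v ∈ S, w v * l v = l x := by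
      rw [← hwx, map_sum]
      simp
    simp only [mul_sub]
    rw [Finset.sum_sub_distrib, ← Finset.sum_mul, hw1, h1, one_mul, sub_self]
  rw [Finset.sum_eq_zero_iff_of_nonneg fun v hv =>
    mul_nonneg (hw v hv).le (sub_nonneg.2 (hx.2 v (hS hv)))] at hsum
  intro v hv
  have hv0 : l x - l v = 0 := (mul_eq_zero.1 (hsum v hv)).resolve_left (hw v hv).ne'
  exact ⟨hS hv, fun y hy => (hx.2 y hy).trans (sub_eq_zero.1 hv0).le⟩

theorem IsPolytope.exists_isProperCombination_face (hX : IsPolytope X) {K : Set (Vec n)}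
    (hK : IsExposed ℝ X K) {x : Vec n} (hx : x ∈ K) :
    ∃ S : Finset (Vec n), (S : Set (Vec n)) ⊆ K ∩ vertices X ∧ IsProperCombination S x := by
  obtain ⟨S, hS, h⟩ := hX.exists_isProperCombination (hK.subset hx)
  exact ⟨S, Set.subset_inter (h.subset_of_isExposed hK hx (hS.trans extremePoints_subset)) hS, h⟩

/-- The feasible directions are generated by the directions to the vertices. -/
theorem IsPolytope.feasibleCone_eq (hX : IsPolytope X) {x : Vec n} (hx : x ∈ X) :
    feasibleCone X x = genCone hX.finite_vertices.toFinset fun v => v - x := by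
  apply Set.Subset.antisymm
  · rintro _ ⟨c, hc, y, hy, rfl⟩
    rw [← hX.convexHull_vertices, ← hX.finite_vertices.coe_toFinset, Finset.mem_convexHull'] at hy
    obtain ⟨w, hw, hw1, rfl⟩ := hy
    refine smul_mem_genCone ⟨w, hw, ?_⟩ hc
    simp only [smul_sub]
    rw [Finset.sum_sub_distrib, ← Finset.sum_smul, hw1, one_smul]
  · rintro _ ⟨w, hw, rfl⟩
    have hW : 0 ≤ ∑ v ∈ hX.finite_vertices.toFinset, w v := Finset.sum_nonneg hw
    rcases hW.eq_or_lt with h0 | hpos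
    · refine ⟨0, le_rfl, x, hx, ?_⟩
      rw [zero_smul]
      refine Finset.sum_eq_zero fun v hv => ?_
      rw [(Finset.sum_eq_zero_iff_of_nonneg hw).1 h0.symm v hv, zero_smul]
    · refine ⟨_, hW, Finset.centerMass hX.finite_vertices.toFinset w id,
        hX.convex.centerMass_mem hw hpos fun v hv =>
          extremePoints_subset (hX.finite_vertices.mem_toFinset.1 hv), ?_⟩
      simp only [smul_sub]
      rw [Finset.sum_sub_distrib, ← Finset.sum_smul, Finset.centerMass, smul_smul,
        mul_inv_cancel₀ hpos.ne', one_smul]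
      simp

/-- The difference of two convex combinations lies in the cone of the differences of their
points. -/
theorem sub_mem_genCone {S T : Finset (Vec n)} {x y : Vec n} (hx : IsProperCombination S x)
    (hy : IsProperCombination T y) :
    y - x ∈ genCone (T ×ˢ S) fun p : Vec n × Vec n => p.1 - p.2 := by
  obtain ⟨w, hw, hw1, rfl⟩ := hx
  obtain ⟨w', hw', hw1', rfl⟩ := hy
  refine ⟨fun p => w' p.1 * w p.2, fun p hp => ?_, ?_⟩
  · obtain ⟨h1, h2⟩ := Finset.mem_product.1 hp
    exact (mul_pos (hw' _ h1) (hw _ h2)).le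
  · rw [Finset.sum_product]
    have : ∀ k ∈ T, ∑ v ∈ S, (w' k * w v) • (k - v) = w' k • k - w' k • ∑ v ∈ S, w v • v := by
      intro k _
      simp only [smul_sub, mul_smul]
      rw [Finset.sum_sub_distrib, ← Finset.smul_sum, ← Finset.smul_sum, ← Finset.sum_smul, hw1,
        one_smul]
    rw [Finset.sum_congr rfl this, Finset.sum_sub_distrib, ← Finset.sum_smul, hw1', one_smul]

theorem bddAbove_inner_sub {A : Set (Vec n)} (hA : A.Finite) (S : Finset (Vec n)) (r : Vec n) :
    BddAbove {c : ℝ | ∃ s ∈ A, ∃ v ∈ S, c = inner ℝ r (s - v)} := by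
  refine ((hA.prod S.finite_toSet).image fun p => inner ℝ r (p.1 - p.2)).bddAbove.mono ?_
  rintro _ ⟨s, hs, v, hv, rfl⟩
  exact ⟨(s, v), ⟨hs, hv⟩, rfl⟩

/-- A uniform positive lower bound for all the quantities of which the pyramidal width is the
infimum. -/
theorem IsPolytope.exists_pos_le_sSup (hX : IsPolytope X) :
    ∃ ε : ℝ, 0 < ε ∧ ∀ K : Set (Vec n), IsExposed ℝ X K → ∀ x ∈ K, ∀ r ∈ feasibleCone K x,
      r ≠ 0 → ∀ S : Finset (Vec n), (S : Set (Vec n)) ⊆ K ∩ vertices X → IsProperCombination S x →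
        ε ≤ sSup {c : ℝ | ∃ s ∈ K ∩ vertices X, ∃ v ∈ S, c = inner ℝ (‖r‖⁻¹ • r) (s - v)} := by
  classical
  -- The base points and directions form a continuum, but `r` always lies in the cone of differences
  -- `T - S` of two vertex sets. There are finitely many such pairs, so the least of their constants
  -- is positive.
  choose ε hε hεle using fun p : Finset (Vec n) × Finset (Vec n) =>
    exists_pos_mul_norm_le_inner (p.1 ×ˢ p.2) fun q : Vec n × Vec n => q.1 - q.2
  set V := hX.finite_vertices.toFinset with hV
  have hne : (V.powerset ×ˢ V.powerset).Nonempty :=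
    ⟨(∅, ∅), by simp⟩
  refine ⟨(V.powerset ×ˢ V.powerset).inf' hne ε, (Finset.lt_inf'_iff hne).2 fun p _ => hε p, ?_⟩
  rintro K hK x hx _ ⟨c, hc, y, hy, rfl⟩ hr S hS hSx
  set r := c • (y - x)
  obtain ⟨T, hT, hTy⟩ := hX.exists_isProperCombination_face hK hy
  have hsub : ∀ S : Finset (Vec n), (S : Set (Vec n)) ⊆ K ∩ vertices X → S ∈ V.powerset :=
    fun S hS => Finset.mem_powerset.2 fun v hv => hX.finite_vertices.mem_toFinset.2 (hS hv).2
  obtain ⟨⟨s, v⟩, hsv, hle⟩ := hεle (T, S) r (smul_mem_genCone (sub_mem_genCone hSx hTy) hc) hr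
  obtain ⟨hs, hv⟩ := Finset.mem_product.1 hsv
  refine (Finset.inf'_le ε (Finset.mk_mem_product (hsub T hT) (hsub S hS))).trans
    (le_trans ?_ (le_csSup (bddAbove_inner_sub (hX.finite_vertices.inter_of_right K) S _)
      ⟨s, hT hs, v, hv, rfl⟩))
  have hr' : 0 < ‖r‖ := norm_pos_iff.2 hr
  rw [real_inner_smul_left, ← div_eq_inv_mul, le_div_iff₀ hr']
  exact hle

theorem IsPolytope.exists_pos_le_pyramidalDirWidth (hX : IsPolytope X) :
    ∃ ε : ℝ, 0 < ε ∧ ∀ K : Set (Vec n), IsExposed ℝ X K → ∀ x ∈ K, ∀ r ∈ feasibleCone K x,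
      r ≠ 0 → ε ≤ pyramidalDirWidth (K ∩ vertices X) r x := by
  obtain ⟨ε, hε, h⟩ := hX.exists_pos_le_sSup
  refine ⟨ε, hε, fun K hK x hx r hr hr0 => ?_⟩
  obtain ⟨S, hS, hSx⟩ := hX.exists_isProperCombination_face hK hx
  refine le_csInf ⟨_, S, hS, hSx, rfl⟩ ?_
  rintro _ ⟨S, hS, hSx, rfl⟩
  exact h K hK x hx r hr hr0 S hS hSx

/-- The pyramidal directional width is at most the width of each pyramid. -/
theorem IsPolytope.pyramidalDirWidth_le (hX : IsPolytope X) {K : Set (Vec n)}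
    (hK : IsExposed ℝ X K) {x r : Vec n} (hx : x ∈ K) (hr : r ∈ feasibleCone K x) (hr0 : r ≠ 0)
    {S : Finset (Vec n)} (hS : (S : Set (Vec n)) ⊆ K ∩ vertices X) (hSx : IsProperCombination S x)
    {b : ℝ} (hb : ∀ s ∈ K ∩ vertices X, ∀ v ∈ S, inner ℝ r (s - v) ≤ b * ‖r‖) :
    pyramidalDirWidth (K ∩ vertices X) r x ≤ b := by
  obtain ⟨ε, hε, h⟩ := hX.exists_pos_le_sSup
  have hbdd : BddBelow {m : ℝ | ∃ S : Finset (Vec n), (S : Set (Vec n)) ⊆ K ∩ vertices X ∧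
      IsProperCombination S x ∧ m = sSup {c : ℝ | ∃ s ∈ K ∩ vertices X, ∃ v ∈ S,
        c = inner ℝ (‖r‖⁻¹ • r) (s - v)}} := by
    refine ⟨ε, ?_⟩
    rintro _ ⟨S, hS, hSx, rfl⟩
    exact h K hK x hx r hr hr0 S hS hSx
  refine (csInf_le hbdd ⟨S, hS, hSx, rfl⟩).trans (csSup_le ?_ ?_)
  · obtain ⟨v, hv⟩ := hSx.nonempty
    exact ⟨_, v, hS hv, v, hv, rfl⟩
  · rintro _ ⟨s, hs, v, hv, rfl⟩
    rw [real_inner_smul_left, ← div_eq_inv_mul, div_le_iff₀ (norm_pos_iff.2 hr0)]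
    exact hb s hs v hv

/-- A real `sInf` lies below the members of its set only if the set is bounded below, which the
uniform `ε` ensures. -/
theorem IsPolytope.pyramidalWidth_le (hX : IsPolytope X) {K : Set (Vec n)}
    (hK : IsExposed ℝ X K) {x r : Vec n} (hx : x ∈ K) (hr : r ∈ feasibleCone K x) (hr0 : r ≠ 0) :
    pyramidalWidth X ≤ pyramidalDirWidth (K ∩ vertices X) r x := by
  obtain ⟨ε, hε, h⟩ := hX.exists_pos_le_pyramidalDirWidth
  refine csInf_le ⟨ε, ?_⟩ ⟨K, hK, x, hx, r, hr, hr0, rfl⟩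
  rintro _ ⟨K, hK, x, hx, r, hr, hr0, rfl⟩
  exact h K hK x hx r hr hr0

theorem sub_mem_feasibleCone {K : Set (Vec n)} {x y : Vec n} (hy : y ∈ K) :
    y - x ∈ feasibleCone K x := ⟨1, zero_le_one, y, hy, by simp⟩

theorem IsPolytope.pyramidalWidth_pos (hX : IsPolytope X) (hne : X.Nontrivial) :
    0 < pyramidalWidth X := by
  obtain ⟨ε, hε, h⟩ := hX.exists_pos_le_pyramidalDirWidth
  obtain ⟨x, hx, y, hy, hxy⟩ := hne
  refine hε.trans_le (le_csInf ⟨_, X, IsExposed.refl X, x, hx, y - x, sub_mem_feasibleCone hy,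
    sub_ne_zero.2 hxy.symm, rfl⟩ ?_)
  rintro _ ⟨K, hK, x, hx, r, hr, hr0, rfl⟩
  exact h K hK x hx r hr hr0

/-- Needed to keep the contraction factor away from zero: Cauchy-Schwarz bounds each pyramid width
by the diameter. -/
theorem IsPolytope.pyramidalWidth_le_diam (hX : IsPolytope X) (hne : X.Nontrivial) :
    pyramidalWidth X ≤ Metric.diam X := by
  obtain ⟨x, hx, y, hy, hxy⟩ := hne
  have hr0 : y - x ≠ 0 := sub_ne_zero.2 hxy.symm
  obtain ⟨S, hS, hSx⟩ := hX.exists_isProperCombination_face (IsExposed.refl X) hx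
  refine (hX.pyramidalWidth_le (IsExposed.refl X) hx (sub_mem_feasibleCone hy) hr0).trans
    (hX.pyramidalDirWidth_le (IsExposed.refl X) hx (sub_mem_feasibleCone hy) hr0 hS hSx ?_)
  intro s hs v hv
  rw [mul_comm]
  refine (real_inner_le_norm _ _).trans (mul_le_mul_of_nonneg_left ?_ (norm_nonneg _))
  rw [← dist_eq_norm]
  exact Metric.dist_le_diam_of_mem hX.isCompact.isBounded hs.1 (hS hv).1

/-- The pairwise Frank-Wolfe gap controls the directional derivative towards every point of the
polytope, up to the pyramidal width. -/
theorem IsPolytope.pyramidalWidth_mul_inner_le (hX : IsPolytope X) {x y r s a : Vec n}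
    (hx : x ∈ X) (hy : y ∈ X) {S : Finset (Vec n)} (hS : (S : Set (Vec n)) ⊆ vertices X)
    (hSx : IsProperCombination S x) (hs : ∀ z ∈ X, inner ℝ r z ≤ inner ℝ r s)
    (ha : ∀ z ∈ S, inner ℝ r a ≤ inner ℝ r z) (hpos : 0 < inner ℝ r (y - x)) :
    pyramidalWidth X * inner ℝ r (y - x) ≤ inner ℝ r (s - a) * ‖y - x‖ := by
  have hC := hX.feasibleCone_eq hx
  obtain ⟨p, hp, hpp, hpC⟩ := exists_cone_projection (C := feasibleCone X x)
    (hC ▸ isClosed_genCone _ _) (hC ▸ convex_genCone _ _) ⟨0, le_rfl, x, hx, by simp⟩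
    (fun z hz c hc => hC ▸ smul_mem_genCone (hC ▸ hz) hc) r
  have hpX : ∀ z ∈ X, inner ℝ (r - p) z ≤ inner ℝ (r - p) x := fun z hz => by
    have := hpC _ (sub_mem_feasibleCone hz)
    rw [inner_sub_right] at this
    linarith
  have hry : inner ℝ r (y - x) ≤ ‖p‖ * ‖y - x‖ := by
    have h1 := hpC _ (sub_mem_feasibleCone hy)
    rw [inner_sub_left] at h1
    have h2 := real_inner_le_norm p (y - x)
    linarith
  have hp0 : p ≠ 0 := by
    rintro rfl
    simp at hry
    linarith
  have hyx : 0 < ‖y - x‖ := by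
    rw [norm_pos_iff]
    intro h0
    simp [h0] at hpos
  -- The residual `r - p` is nonpositive on the feasible cone, so it is maximal over `X` at `x` and
  -- exposes a face through `x`.
  set K : Set (Vec n) := (innerSL ℝ (r - p)).toExposed X with hKdef
  have hK : IsExposed ℝ X K := ContinuousLinearMap.toExposed.isExposed
  have hmemK : ∀ z, z ∈ K ↔ z ∈ X ∧ inner ℝ (r - p) z = inner ℝ (r - p) x := by
    intro z
    constructor
    · rintro ⟨hz, hz'⟩
      exact ⟨hz, le_antisymm (hpX z hz) (hz' x hx)⟩
    · rintro ⟨hz, hz'⟩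
      exact ⟨hz, fun w hw => (hpX w hw).trans_eq hz'.symm⟩
  have hxK : x ∈ K := (hmemK x).2 ⟨hx, rfl⟩
  -- With `p = c • (z - x)`, orthogonality of `p` to the residual puts `z` on the same face.
  have hpK : p ∈ feasibleCone K x := by
    obtain ⟨c, hc, z, hz, hcz⟩ := hp
    have hc0 : c ≠ 0 := by
      rintro rfl
      exact hp0 (by simpa using hcz)
    refine ⟨c, hc, z, (hmemK z).2 ⟨hz, ?_⟩, hcz⟩
    nth_rewrite 2 [hcz] at hpp
    rw [real_inner_smul_right, inner_sub_right] at hpp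
    have := (mul_eq_zero.1 hpp).resolve_left hc0
    linarith
  have hSK := hSx.subset_of_isExposed hK hxK (hS.trans extremePoints_subset)
  have hp' : 0 < ‖p‖ := norm_pos_iff.2 hp0
  have hwidth : pyramidalWidth X ≤ inner ℝ r (s - a) / ‖p‖ := by
    refine (hX.pyramidalWidth_le hK hxK hpK hp0).trans
      (hX.pyramidalDirWidth_le hK hxK hpK hp0 (Set.subset_inter hSK hS) hSx ?_)
    -- The residual is constant on `K`, so there `⟨p, z - v⟩ = ⟨r, z - v⟩`, and the extremality of
    -- `s` and `a` applies.
    intro z hz v hv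
    rw [div_mul_cancel₀ _ hp'.ne']
    have h1 := ((hmemK z).1 hz.1).2
    have h2 := ((hmemK v).1 (hSK hv)).2
    have h3 := hs z ((hmemK z).1 hz.1).1
    have h4 := ha v hv
    rw [inner_sub_left, inner_sub_left] at h1 h2
    rw [inner_sub_right, inner_sub_right]
    linarith
  rw [le_div_iff₀ hp'] at hwidth
  have hw := (hX.pyramidalWidth_pos ⟨x, hx, y, hy, by rintro rfl; simp at hyx⟩).le
  calc pyramidalWidth X * inner ℝ r (y - x) ≤ pyramidalWidth X * (‖p‖ * ‖y - x‖) := by gcongr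
    _ = pyramidalWidth X * ‖p‖ * ‖y - x‖ := by ring
    _ ≤ _ := by gcongr

end Polytopes

/-! ### Generalized self-concordant functions -/

section Calculus

/-- The second-derivative bound is integrated twice by comparison. The bound on `ψ b` is kept
because the line search needs the sign of the slope. -/
theorem le_quadratic_of_deriv2_le {φ ψ χ : ℝ → ℝ} {b C : ℝ} (hb : 0 ≤ b)
    (hφ : ∀ s ∈ Set.Icc 0 b, HasDerivAt φ (ψ s) s) (hψ : ∀ s ∈ Set.Icc 0 b, HasDerivAt ψ (χ s) s)
    (hχ : ∀ s ∈ Set.Icc 0 b, χ s ≤ C) :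
    ψ b ≤ ψ 0 + C * b ∧ φ b ≤ φ 0 + ψ 0 * b + C / 2 * b ^ 2 := by
  have h1 : ∀ ⦃s⦄, s ∈ Set.Icc 0 b → ψ s ≤ ψ 0 + C * s := by
    refine image_le_of_deriv_right_le_deriv_boundary (f' := χ) (B' := fun _ => C)
      (fun s hs => (hψ s hs).continuousAt.continuousWithinAt)
      (fun s hs => (hψ s (Set.Ico_subset_Icc_self hs)).hasDerivWithinAt) (by simp)
      (by fun_prop) (fun s _ => ?_) (fun s hs => hχ s (Set.Ico_subset_Icc_self hs))
    simpa using (((hasDerivAt_id s).const_mul C).const_add (ψ 0)).hasDerivWithinAt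
  refine ⟨h1 ⟨hb, le_rfl⟩, ?_⟩
  have h2 : ∀ ⦃s⦄, s ∈ Set.Icc 0 b → φ s ≤ φ 0 + ψ 0 * s + C / 2 * s ^ 2 := by
    refine image_le_of_deriv_right_le_deriv_boundary (f' := ψ) (B' := fun s => ψ 0 + C * s)
      (fun s hs => (hφ s hs).continuousAt.continuousWithinAt)
      (fun s hs => (hφ s (Set.Ico_subset_Icc_self hs)).hasDerivWithinAt) (by simp)
      (by fun_prop) (fun s _ => ?_) (fun s hs => h1 (Set.Ico_subset_Icc_self hs))
    have := (((hasDerivAt_id s).const_mul (ψ 0)).const_add (φ 0)).add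
      (((hasDerivAt_id s).pow 2).const_mul (C / 2))
    refine (this.congr_deriv ?_).hasDerivWithinAt
    simp
    ring
  exact h2 ⟨hb, le_rfl⟩

theorem quadratic_le_of_le_deriv2 {φ ψ χ : ℝ → ℝ} {b C : ℝ} (hb : 0 ≤ b)
    (hφ : ∀ s ∈ Set.Icc 0 b, HasDerivAt φ (ψ s) s) (hψ : ∀ s ∈ Set.Icc 0 b, HasDerivAt ψ (χ s) s)
    (hχ : ∀ s ∈ Set.Icc 0 b, C ≤ χ s) :
    φ 0 + ψ 0 * b + C / 2 * b ^ 2 ≤ φ b := by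
  have := (le_quadratic_of_deriv2_le hb (fun s hs => (hφ s hs).neg) (fun s hs => (hψ s hs).neg)
    (fun s hs => neg_le_neg (hχ s hs))).2
  simp only [Pi.neg_apply] at this
  linarith

end Calculus

/-! ### Behaviour along lines and definiteness of the Hessian -/

section SelfConcordant

variable {n : ℕ} {M ν : ℝ} {f : Vec n → WithTop ℝ}

theorem coe_val {x : Vec n} (hx : x ∈ dom f) : ((val f x : ℝ) : WithTop ℝ) = f x := by
  have hx' : f x < ⊤ := hx
  obtain ⟨c, hc⟩ := WithTop.ne_top_iff_exists.1 hx'.ne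
  rw [val, ← hc, WithTop.untopD_coe]

theorem le_coe_iff {x : Vec n} {c : ℝ} : f x ≤ (c : WithTop ℝ) ↔ x ∈ dom f ∧ val f x ≤ c := by
  constructor
  · intro h
    have hx : x ∈ dom f := lt_of_le_of_lt h (WithTop.coe_lt_top c)
    exact ⟨hx, WithTop.coe_le_coe.1 (by rwa [coe_val hx])⟩
  · rintro ⟨hx, h⟩
    rw [← coe_val hx]
    exact WithTop.coe_le_coe.2 h

theorem mem_epigraph_iff {x : Vec n} {c : ℝ} :
    (x, c) ∈ epigraph f ↔ x ∈ dom f ∧ val f x ≤ c := le_coe_iff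

theorem hess_smul (f : Vec n → WithTop ℝ) (x u : Vec n) (c : ℝ) :
    hess f x (c • u) (c • u) = c ^ 2 * hess f x u u := by
  simp [hess, sq, mul_assoc]

theorem inner_grad (f : Vec n → WithTop ℝ) (x d : Vec n) :
    inner ℝ (grad f x) d = fderiv ℝ (val f) x d := inner_gradient_left

namespace IsGenSelfConcordant

variable (hf : IsGenSelfConcordant M ν f)
include hf

theorem convexOn_val : ConvexOn ℝ (dom f) (val f) := by
  rw [convexOn_iff_convex_epigraph]
  convert hf.convex using 1
  ext ⟨x, c⟩
  exact mem_epigraph_iff.symm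

theorem contDiffAt {x : Vec n} (hx : x ∈ dom f) : ContDiffAt ℝ 3 (val f) x :=
  hf.contDiffOn.contDiffAt (hf.isOpen_dom.mem_nhds hx)

theorem contDiffAt_fderiv {x : Vec n} (hx : x ∈ dom f) : ContDiffAt ℝ 2 (fderiv ℝ (val f)) x :=
  (hf.contDiffAt hx).fderiv_right (by norm_num)

theorem contDiffAt_fderiv2 {x : Vec n} (hx : x ∈ dom f) :
    ContDiffAt ℝ 1 (fderiv ℝ (fderiv ℝ (val f))) x :=
  (hf.contDiffAt_fderiv hx).fderiv_right (by norm_num)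

omit hf in
theorem hasDerivAt_line {F : Type*} [NormedAddCommGroup F] [NormedSpace ℝ F] {g : Vec n → F}
    {x d : Vec n} {s : ℝ} (hg : DifferentiableAt ℝ g (x + s • d)) :
    HasDerivAt (fun s : ℝ => g (x + s • d)) (fderiv ℝ g (x + s • d) d) s := by
  have h : HasDerivAt (fun s : ℝ => x + s • d) d s := by
    simpa using ((hasDerivAt_id s).smul_const d).const_add x
  exact hg.hasFDerivAt.comp_hasDerivAt s h

theorem hasDerivAt_val {x d : Vec n} {s : ℝ} (h : x + s • d ∈ dom f) :
    HasDerivAt (fun s : ℝ => val f (x + s • d)) (fderiv ℝ (val f) (x + s • d) d) s :=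
  hasDerivAt_line ((hf.contDiffAt h).differentiableAt (by norm_num))

theorem hasDerivAt_fderiv {x d : Vec n} {s : ℝ} (h : x + s • d ∈ dom f) :
    HasDerivAt (fun s : ℝ => fderiv ℝ (val f) (x + s • d) d) (hess f (x + s • d) d d) s := by
  have := (hasDerivAt_line ((hf.contDiffAt_fderiv h).differentiableAt (by norm_num))).clm_apply
    (hasDerivAt_const s d)
  simpa [hess] using this

theorem hasDerivAt_hess {x d : Vec n} {s : ℝ} (h : x + s • d ∈ dom f) :
    HasDerivAt (fun s : ℝ => hess f (x + s • d) d d) (third f (x + s • d) d d) s := by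
  have := ((hasDerivAt_line ((hf.contDiffAt_fderiv2 h).differentiableAt (by norm_num))).clm_apply
    (hasDerivAt_const s d)).clm_apply (hasDerivAt_const s d)
  simpa [hess, third] using this

theorem continuousOn_hess : ContinuousOn (fun p : Vec n × Vec n => hess f p.1 p.2 p.2)
    (dom f ×ˢ Set.univ) := by
  have h : ContinuousOn (fun p : Vec n × Vec n => fderiv ℝ (fderiv ℝ (val f)) p.1)
      (dom f ×ˢ Set.univ) := fun p hp =>
    ((hf.contDiffAt_fderiv2 hp.1).continuousAt.comp continuousAt_fst).continuousWithinAt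
  exact (h.clm_apply continuousOn_snd).clm_apply continuousOn_snd

theorem segment_mem_dom {x d : Vec n} {b s : ℝ} (hx : x ∈ dom f) (hb : x + b • d ∈ dom f)
    (hs : s ∈ Set.Icc 0 b) : x + s • d ∈ dom f := by
  rcases hs.1.eq_or_lt with rfl | hs0
  · simpa using hx
  · have hb0 : 0 < b := hs0.trans_le hs.2
    have := hf.convexOn_val.1.add_smul_mem hx hb (t := s / b)
      ⟨div_nonneg hs.1 hb0.le, (div_le_one hb0).2 hs.2⟩
    rwa [smul_smul, div_mul_cancel₀ _ hb0.ne'] at this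

/-- On a line through `x` the function is convex, its derivative monotone, and the Hessian form is
the derivative of that. -/
theorem hess_nonneg {x : Vec n} (hx : x ∈ dom f) (d : Vec n) : 0 ≤ hess f x d d := by
  set T : Set ℝ := {s | x + s • d ∈ dom f} with hT
  have hTo : IsOpen T := hf.isOpen_dom.preimage (by fun_prop)
  have h0 : (0 : ℝ) ∈ T := by simpa [hT] using hx
  have hconv : ConvexOn ℝ T fun s : ℝ => val f (x + s • d) := by
    have hl : ⇑(AffineMap.lineMap x (x + d) : ℝ →ᵃ[ℝ] Vec n) = fun s : ℝ => x + s • d := by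
      funext s
      rw [AffineMap.lineMap_apply_module', add_sub_cancel_left, add_comm]
    have := hf.convexOn_val.comp_affineMap (AffineMap.lineMap x (x + d))
    rw [hl] at this
    exact this
  have hmono := hconv.monotoneOn_deriv fun s hs => (hf.hasDerivAt_val hs).differentiableAt
  have hmono' : MonotoneOn (fun s : ℝ => fderiv ℝ (val f) (x + s • d) d) T :=
    hmono.congr fun s hs => (hf.hasDerivAt_val hs).deriv
  have := hmono'.derivWithin_nonneg (x := (0 : ℝ))
  rw [derivWithin_of_isOpen hTo h0, (hf.hasDerivAt_fderiv h0).deriv] at this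
  simpa using this

theorem hessNorm_sq {x : Vec n} (hx : x ∈ dom f) (d : Vec n) : hessNorm f x d ^ 2 = hess f x d d :=
  Real.sq_sqrt (hf.hess_nonneg hx d)

/-- If the Hessian degenerates in the direction `d` at one point, it does so along the ray. -/
theorem hess_ray_eq_zero (hν : 2 ≤ ν) {x d : Vec n} (hx : x ∈ dom f) (h0 : hess f x d d = 0)
    {b : ℝ} (hb : x + b • d ∈ dom f) {s : ℝ} (hs : s ∈ Set.Icc 0 b) :
    hess f (x + s • d) d d = 0 := by
  have hmem : ∀ s ∈ Set.Icc 0 b, x + s • d ∈ dom f := fun s hs => hf.segment_mem_dom hx hb hs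
  have hcont : ContinuousOn (fun s : ℝ => hess f (x + s • d) d d) (Set.Icc 0 b) :=
    fun s hs => (hf.hasDerivAt_hess (hmem s hs)).continuousAt.continuousWithinAt
  have hcontk : ContinuousOn (fun s : ℝ => M * hessNorm f (x + s • d) d ^ (ν - 2) * ‖d‖ ^ (3 - ν))
      (Set.Icc 0 b) :=
    (continuousOn_const.mul (hcont.sqrt.rpow_const fun _ _ => Or.inr (by linarith))).mul
      continuousOn_const
  -- As `ν ≥ 2`, the factor multiplying the Hessian form in the self-concordance bound is continuous
  -- on the segment, hence bounded. Grönwall's inequality then propagates the zero.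
  obtain ⟨k, hk⟩ := (isCompact_Icc.image_of_continuousOn hcontk).bddAbove
  refine eq_zero_of_abs_deriv_le_mul_abs_self_of_eq_zero_right (K := k) hcont
    (fun s hs => (hf.hasDerivAt_hess (hmem s (Set.Ico_subset_Icc_self hs))).hasDerivWithinAt)
    (by simpa using h0) (fun s hs => ?_) s hs
  have hs' := Set.Ico_subset_Icc_self hs
  have hbound := hf.bound _ (hmem s hs') d d
  rw [hf.hessNorm_sq (hmem s hs')] at hbound
  rw [Real.norm_eq_abs, Real.norm_eq_abs, abs_of_nonneg (hf.hess_nonneg (hmem s hs') d)]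
  refine hbound.trans ?_
  calc _ = (M * hessNorm f (x + s • d) d ^ (ν - 2) * ‖d‖ ^ (3 - ν)) * hess f (x + s • d) d d := by
        ring
    _ ≤ _ := mul_le_mul_of_nonneg_right (hk ⟨s, hs', rfl⟩) (hf.hess_nonneg (hmem s hs') d)

theorem val_ray_eq (hν : 2 ≤ ν) {x d : Vec n} (hx : x ∈ dom f) (h0 : hess f x d d = 0)
    {b : ℝ} (hb0 : 0 ≤ b) (hb : x + b • d ∈ dom f) :
    val f (x + b • d) = val f x + fderiv ℝ (val f) x d * b := by
  have hmem : ∀ s ∈ Set.Icc 0 b, x + s • d ∈ dom f := fun s hs => hf.segment_mem_dom hx hb hs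
  have hz : ∀ s ∈ Set.Icc 0 b, hess f (x + s • d) d d = 0 := fun s hs =>
    hf.hess_ray_eq_zero hν hx h0 hb hs
  have h1 := (le_quadratic_of_deriv2_le hb0 (fun s hs => hf.hasDerivAt_val (hmem s hs))
    (fun s hs => hf.hasDerivAt_fderiv (hmem s hs)) (fun s hs => (hz s hs).le)).2
  have h2 := quadratic_le_of_le_deriv2 hb0 (fun s hs => hf.hasDerivAt_val (hmem s hs))
    (fun s hs => hf.hasDerivAt_fderiv (hmem s hs)) (fun s hs => (hz s hs).ge)
  simp only [zero_smul, add_zero] at h1 h2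
  linarith

/-- The Hessian is positive definite if the domain contains no straight line. -/
theorem hess_pos (hν : 2 ≤ ν) (hline : ContainsNoLine (dom f)) {x d : Vec n} (hx : x ∈ dom f)
    (hd : d ≠ 0) : 0 < hess f x d d := by
  refine (hf.hess_nonneg hx d).lt_of_ne' fun h0 => ?_
  have hval : ∀ s : ℝ, x + s • d ∈ dom f →
      val f (x + s • d) = val f x + fderiv ℝ (val f) x d * s := by
    intro s hs
    rcases le_total 0 s with h | h
    · exact hf.val_ray_eq hν hx h0 h hs
    · have h0' : hess f x (-d) (-d) = 0 := by simpa [hess] using h0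
      have := hf.val_ray_eq hν hx h0' (b := -s) (by linarith) (by simpa using hs)
      simpa using this
  set T : Set ℝ := {s | x + s • d ∈ dom f} with hT
  have hTo : IsOpen T := hf.isOpen_dom.preimage (by fun_prop)
  -- Along the line the affine function is the value of `f` wherever `f` is finite, so the domain is
  -- cut out by the closed epigraph: `T` is both open and closed.
  have hTe : T = (fun s : ℝ => (x + s • d, val f x + fderiv ℝ (val f) x d * s)) ⁻¹' epigraph f := by
    ext s
    exact ⟨fun hs => mem_epigraph_iff.2 ⟨hs, (hval s hs).le⟩, fun hs => (mem_epigraph_iff.1 hs).1⟩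
  have hTc : IsClosed T := by
    rw [hTe]
    exact hf.closed.preimage (by fun_prop)
  have hTu : T = Set.univ := IsClopen.eq_univ ⟨hTc, hTo⟩ ⟨0, by simpa [hT] using hx⟩
  obtain ⟨s, hs⟩ := hline x d hd
  exact hs (hTu ▸ Set.mem_univ s : s ∈ T)

end IsGenSelfConcordant

/-! ### The initial level set -/

variable {X : Set (Vec n)} {x₀ : Vec n}

theorem mem_initialLevel (hx₀ : x₀ ∈ dom f) {x : Vec n} :
    x ∈ initialLevel f X x₀ ↔ x ∈ dom f ∧ x ∈ X ∧ val f x ≤ val f x₀ := by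
  have : x ∈ initialLevel f X x₀ ↔ x ∈ dom f ∧ x ∈ X ∧ f x ≤ f x₀ := Iff.rfl
  rw [this, ← coe_val hx₀, le_coe_iff]
  tauto

namespace IsGenSelfConcordant

variable (hf : IsGenSelfConcordant M ν f)
include hf

/-- The level set is a horizontal section of the epigraph, hence closed in the whole space and not
only relative to the open domain. -/
theorem isClosed_level (c : ℝ) : IsClosed {x | x ∈ dom f ∧ val f x ≤ c} := by
  have : {x | x ∈ dom f ∧ val f x ≤ c} = (fun x => (x, c)) ⁻¹' epigraph f := by
    ext x
    exact mem_epigraph_iff.symm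
  rw [this]
  exact hf.closed.preimage (by fun_prop)

theorem isCompact_initialLevel (hX : IsPolytope X) (hx₀ : x₀ ∈ dom f) :
    IsCompact (initialLevel f X x₀) := by
  have : initialLevel f X x₀ = X ∩ {x | x ∈ dom f ∧ val f x ≤ val f x₀} := by
    ext x
    rw [mem_initialLevel hx₀]
    exact ⟨fun h => ⟨h.2.1, h.1, h.2.2⟩, fun h => ⟨h.2.1, h.1, h.2.2⟩⟩
  rw [this]
  exact hX.isCompact.inter_right (hf.isClosed_level _)

theorem convex_initialLevel (hX : IsPolytope X) (hx₀ : x₀ ∈ dom f) :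
    Convex ℝ (initialLevel f X x₀) := by
  have : initialLevel f X x₀ = X ∩ {x ∈ dom f | val f x ≤ val f x₀} := by
    ext x
    rw [mem_initialLevel hx₀]
    exact ⟨fun h => ⟨h.2.1, h.1, h.2.2⟩, fun h => ⟨h.2.1, h.1, h.2.2⟩⟩
  rw [this]
  exact hX.convex.inter (hf.convexOn_val.convex_le _)

/-- The quotient is homogeneous of degree zero in `d`, so unit vectors suffice. Compactness makes
`smoothConst` and `strongConst` genuine bounds. -/
theorem isCompact_quotients {C : Set (Vec n)} (hC : IsCompact C) (hCd : C ⊆ dom f) :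
    IsCompact {q : ℝ | ∃ u ∈ C, ∃ d : Vec n, d ≠ 0 ∧ q = hessNorm f u d ^ 2 / ‖d‖ ^ 2} := by
  have : {q : ℝ | ∃ u ∈ C, ∃ d : Vec n, d ≠ 0 ∧ q = hessNorm f u d ^ 2 / ‖d‖ ^ 2} =
      (fun p : Vec n × Vec n => hess f p.1 p.2 p.2) '' (C ×ˢ Metric.sphere 0 1) := by
    ext q
    constructor
    · rintro ⟨u, hu, d, hd, rfl⟩
      refine ⟨(u, ‖d‖⁻¹ • d), ⟨hu, by simp [norm_smul, hd]⟩, ?_⟩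
      simp only
      rw [hess_smul, hf.hessNorm_sq (hCd hu), inv_pow, div_eq_inv_mul]
    · rintro ⟨⟨u, d⟩, ⟨hu, hd⟩, rfl⟩
      have hd1 : ‖d‖ = 1 := by simpa using hd
      refine ⟨u, hu, d, by rintro rfl; simp at hd1, ?_⟩
      rw [hf.hessNorm_sq (hCd hu), hd1]
      simp
  rw [this]
  exact (hC.prod (isCompact_sphere 0 1)).image_of_continuousOn
    (hf.continuousOn_hess.mono (Set.prod_mono hCd (Set.subset_univ _)))

theorem hess_le_smoothConst {C : Set (Vec n)} (hC : IsCompact C) (hCd : C ⊆ dom f) {u : Vec n}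
    (hu : u ∈ C) (d : Vec n) : hess f u d d ≤ smoothConst f C * ‖d‖ ^ 2 := by
  rcases eq_or_ne d 0 with rfl | hd
  · simp [hess]
  · have := le_csSup (hf.isCompact_quotients hC hCd).bddAbove ⟨u, hu, d, hd, rfl⟩
    rwa [hf.hessNorm_sq (hCd hu), div_le_iff₀ (by positivity)] at this

theorem strongConst_le_hess {C : Set (Vec n)} (hC : IsCompact C) (hCd : C ⊆ dom f) {u : Vec n}
    (hu : u ∈ C) (d : Vec n) : strongConst f C * ‖d‖ ^ 2 ≤ hess f u d d := by
  rcases eq_or_ne d 0 with rfl | hd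
  · simp [hess]
  · have := csInf_le (hf.isCompact_quotients hC hCd).bddBelow ⟨u, hu, d, hd, rfl⟩
    rwa [hf.hessNorm_sq (hCd hu), le_div_iff₀ (by positivity)] at this

theorem strongConst_le_smoothConst {C : Set (Vec n)} (hC : IsCompact C) (hCd : C ⊆ dom f)
    (hne : C.Nonempty) {d : Vec n} (hd : d ≠ 0) : strongConst f C ≤ smoothConst f C := by
  obtain ⟨u, hu⟩ := hne
  have h := (hf.strongConst_le_hess hC hCd hu d).trans (hf.hess_le_smoothConst hC hCd hu d)
  exact le_of_mul_le_mul_right h (by positivity)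

theorem strongConst_pos (hν : 2 ≤ ν) (hline : ContainsNoLine (dom f)) {C : Set (Vec n)}
    (hC : IsCompact C) (hCd : C ⊆ dom f) (hne : C.Nonempty) {d : Vec n} (hd : d ≠ 0) :
    0 < strongConst f C := by
  obtain ⟨u, hu⟩ := hne
  obtain ⟨u', hu', d', hd', h⟩ :=
    (hf.isCompact_quotients hC hCd).sInf_mem ⟨_, u, hu, d, hd, rfl⟩
  rw [strongConst, h, hf.hessNorm_sq (hCd hu')]
  have := hf.hess_pos hν hline (hCd hu') hd'
  positivity

/-- The strong convexity inequality on a convex compact set. -/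
theorem add_strongConst_le {C : Set (Vec n)} (hC : IsCompact C) (hCd : C ⊆ dom f)
    (hconv : Convex ℝ C) {x y : Vec n} (hx : x ∈ C) (hy : y ∈ C) :
    val f x + inner ℝ (grad f x) (y - x) + strongConst f C / 2 * ‖y - x‖ ^ 2 ≤ val f y := by
  have hmem : ∀ s ∈ Set.Icc (0 : ℝ) 1, x + s • (y - x) ∈ C := fun s hs =>
    hconv.add_smul_sub_mem hx hy hs
  have := quadratic_le_of_le_deriv2 zero_le_one (fun s hs => hf.hasDerivAt_val (hCd (hmem s hs)))
    (fun s hs => hf.hasDerivAt_fderiv (hCd (hmem s hs)))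
    (fun s hs => hf.strongConst_le_hess hC hCd (hmem s hs) (y - x))
  simp only [zero_smul, add_zero, one_smul, add_sub_cancel] at this
  rw [inner_grad]
  linarith

/-- The descent lemma on a compact set. -/
theorem le_add_smoothConst {C : Set (Vec n)} (hC : IsCompact C) (hCd : C ⊆ dom f)
    {x d : Vec n} {b : ℝ} (hb : 0 ≤ b) (hmem : ∀ s ∈ Set.Icc 0 b, x + s • d ∈ C) :
    fderiv ℝ (val f) (x + b • d) d ≤
      inner ℝ (grad f x) d + smoothConst f C * ‖d‖ ^ 2 * b ∧
    val f (x + b • d) ≤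
      val f x + inner ℝ (grad f x) d * b + smoothConst f C * ‖d‖ ^ 2 / 2 * b ^ 2 := by
  have := le_quadratic_of_deriv2_le hb (fun s hs => hf.hasDerivAt_val (hCd (hmem s hs)))
    (fun s hs => hf.hasDerivAt_fderiv (hCd (hmem s hs)))
    (fun s hs => hf.hess_le_smoothConst hC hCd (hmem s hs) d)
  simp only [zero_smul, add_zero] at this
  rwa [inner_grad]

end IsGenSelfConcordant

end SelfConcordant

/-! ### The line search -/

section LineSearch

variable {n : ℕ} {M ν : ℝ} {f : Vec n → WithTop ℝ} {X : Set (Vec n)} {x₀ x d : Vec n}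
  {γmax m : ℝ}

theorem trialStep_le (f : Vec n → WithTop ℝ) (x d : Vec n) (γmax m : ℝ) :
    trialStep f x d γmax m ≤ γmax := min_le_right _ _

theorem trialStep_nonneg (hd : inner ℝ (grad f x) d ≤ 0) (hγ : 0 ≤ γmax) (hm : 0 < m) :
    0 ≤ trialStep f x d γmax m :=
  le_min (div_nonneg (by linarith) (by positivity)) hγ

theorem mul_trialStep_le (hm : 0 < m) :
    m * trialStep f x d γmax m * ‖d‖ ^ 2 ≤ -inner ℝ (grad f x) d := by
  rcases eq_or_ne d 0 with rfl | hd0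
  · simp
  · have h : trialStep f x d γmax m ≤ _ := min_le_left _ _
    have hd' : 0 < ‖d‖ := norm_pos_iff.2 hd0
    rw [le_div_iff₀ (by positivity)] at h
    linarith

/-- An accepted step decreases the objective. -/
theorem Accepts.val_le (h : Accepts f x d γmax m) (hd : inner ℝ (grad f x) d ≤ 0)
    (hγ : 0 ≤ γmax) (hm : 0 < m) :
    val f (x + trialStep f x d γmax m • d) ≤
      val f x + trialStep f x d γmax m * inner ℝ (grad f x) d / 2 := by
  have h1 := h.2
  have h2 := mul_le_mul_of_nonneg_left (mul_trialStep_le (f := f) (x := x) (d := d)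
    (γmax := γmax) hm) (trialStep_nonneg hd hγ hm)
  linarith

/-- The smoothness bound holds only inside the level set, so the segment must first be shown to stay
there. Before the trial step is reached the slope is negative, so a point of the level set can be
moved a little further. The descent lemma then gives the test. -/
theorem IsGenSelfConcordant.accepts_of_smoothConst_le (hf : IsGenSelfConcordant M ν f)
    (hX : IsPolytope X) (hx₀ : x₀ ∈ dom f) (hx : x ∈ initialLevel f X x₀)
    (hd : inner ℝ (grad f x) d ≤ 0) (hγ : 0 ≤ γmax) (hxd : x + γmax • d ∈ X) (hm : 0 < m)
    (hLm : smoothConst f (initialLevel f X x₀) ≤ m) : Accepts f x d γmax m := by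
  set C := initialLevel f X x₀ with hCdef
  have hC : IsCompact C := hf.isCompact_initialLevel hX hx₀
  have hCd : C ⊆ dom f := fun y hy => hy.1
  have hxX : x ∈ X := hx.2.1
  have hxv : val f x ≤ val f x₀ := ((mem_initialLevel hx₀).1 hx).2.2
  have hconv : Convex ℝ C := hf.convex_initialLevel hX hx₀
  set γ := trialStep f x d γmax m with hγdef
  have hγ0 : 0 ≤ γ := trialStep_nonneg hd hγ hm
  have hγm : m * γ * ‖d‖ ^ 2 ≤ -inner ℝ (grad f x) d := mul_trialStep_le hm
  have hsub : ∀ {b s : ℝ} {Y : Set (Vec n)}, Convex ℝ Y → x ∈ Y → x + b • d ∈ Y →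
      s ∈ Set.Icc 0 b → x + s • d ∈ Y := by
    intro b s Y hY hxY hb hs
    rcases hs.1.eq_or_lt with rfl | hs0
    · simpa using hxY
    · have hb0 : 0 < b := hs0.trans_le hs.2
      have := hY.add_smul_mem hxY hb (t := s / b)
        ⟨div_nonneg hs.1 hb0.le, (div_le_one hb0).2 hs.2⟩
      rwa [smul_smul, div_mul_cancel₀ _ hb0.ne'] at this
  have hseg : Set.Icc 0 γ ⊆ {s : ℝ | x + s • d ∈ C} := by
    refine IsClosed.Icc_subset_of_forall_exists_gt ?_ (by simpa using hx) ?_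
    · exact (hC.isClosed.preimage (f := fun s : ℝ => x + s • d) (by fun_prop)).inter isClosed_Icc
    · rintro b ⟨hb, hb0, hbγ⟩ y hy
      have hb' : x + b • d ∈ C := hb
      have hmem : ∀ s ∈ Set.Icc 0 b, x + s • d ∈ C := fun s hs => hsub hconv hx hb' hs
      obtain ⟨h1, h2⟩ := hf.le_add_smoothConst hC hCd hb0 hmem
      have hlt : b < min y γ := lt_min hy hbγ
      have hd0 : d ≠ 0 ∨ d = 0 := (eq_or_ne d 0).symm
      rcases hd0 with hd0 | rfl
      · have hd' : 0 < ‖d‖ ^ 2 := by positivity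
        have hLb : smoothConst f C * ‖d‖ ^ 2 * b ≤ m * ‖d‖ ^ 2 * b := by gcongr
        have hmb : m * ‖d‖ ^ 2 * b < m * ‖d‖ ^ 2 * γ := by gcongr
        -- For `b < γ` the slope is below `⟨∇f(x), d⟩ + m‖d‖²γ`, which is nonpositive by the choice
        -- of `γ`.
        have hneg : fderiv ℝ (val f) (x + b • d) d < 0 := by linarith
        have hbv : val f (x + b • d) ≤ val f x₀ := ((mem_initialLevel hx₀).1 hb').2.2
        have hder := hf.hasDerivAt_val (x := x) (d := d) (s := b) (hCd hb')
        have hev1 := (hder.hasDerivWithinAt (s := Set.Ioi b)).limsup_slope_le'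
          (by simp) hneg
        have hev2 : ∀ᶠ s in nhdsWithin b (Set.Ioi b), x + s • d ∈ dom f := by
          refine nhdsWithin_le_nhds ?_
          exact (hf.isOpen_dom.preimage (f := fun s : ℝ => x + s • d) (by fun_prop)).mem_nhds
            (hCd hb')
        have hev3 : ∀ᶠ s in nhdsWithin b (Set.Ioi b), s ∈ Set.Ioo b (min y γ) :=
          Ioo_mem_nhdsGT hlt
        obtain ⟨s, hs1, hs2, hs3⟩ := (hev1.and (hev2.and hev3)).exists
        refine ⟨s, (mem_initialLevel hx₀).2 ⟨hs2, ?_, ?_⟩, hs3.1, hs3.2.le.trans (min_le_left _ _)⟩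
        · exact hsub hX.convex hxX hxd ⟨hb0.trans hs3.1.le,
            (hs3.2.le.trans (min_le_right _ _)).trans (trialStep_le _ _ _ _ _)⟩
        · rw [slope_def_field, div_lt_iff₀ (sub_pos.2 hs3.1), zero_mul] at hs1
          linarith
      · exact ⟨y, by simpa using hx, hy, le_rfl⟩
  have hmem : x + γ • d ∈ C := hseg ⟨hγ0, le_rfl⟩
  refine ⟨hCd hmem, ?_⟩
  have h := (hf.le_add_smoothConst hC hCd hγ0 fun s hs => hseg hs).2
  have h' : smoothConst f C * ‖d‖ ^ 2 / 2 * γ ^ 2 ≤ m * ‖d‖ ^ 2 / 2 * γ ^ 2 := by gcongr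
  rw [← hγdef]
  linarith

/-- If all large estimates are accepted, then the line search terminates. -/
theorem exists_isBacktrack {τ L K : ℝ} (hτ : 1 < τ) (hL : 0 < L)
    (hacc : ∀ m, 0 < m → K ≤ m → Accepts f x d γmax m) :
    ∃ γ L', IsBacktrack τ f x d L γmax γ L' := by
  classical
  have hex : ∃ k : ℕ, Accepts f x d γmax (τ ^ k * L) := by
    obtain ⟨k, hk⟩ := pow_unbounded_of_one_lt (K / L) hτ
    exact ⟨k, hacc _ (by positivity) ((div_lt_iff₀ hL).1 hk).le⟩
  exact ⟨_, _, 1, L, one_pos, le_rfl, ⟨by simp, le_rfl⟩, Nat.find hex,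
    fun j hj => Nat.find_min hex hj, Nat.find_spec hex, rfl, rfl⟩

/-- Either the first estimate, at most `L`, is accepted, or the final one is `τ` times a rejected
estimate, which must be below `K`. -/
theorem IsBacktrack.bounds {τ L K γ L' : ℝ} (h : IsBacktrack τ f x d L γmax γ L') (hτ : 1 < τ)
    (hL : 0 < L) (hacc : ∀ m, 0 < m → K ≤ m → Accepts f x d γmax m) :
    0 < L' ∧ L' ≤ max (τ * K) L ∧ Accepts f x d γmax L' ∧ γ = trialStep f x d γmax L' := by
  obtain ⟨η, m, hη, -, hm, k, hrej, hk, rfl, hγ⟩ := h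
  have hm0 : 0 < m := (mul_pos hη hL).trans_le hm.1
  have hτ0 : 0 < τ := one_pos.trans hτ
  refine ⟨by positivity, ?_, hk, hγ⟩
  rcases k with _ | k
  · exact le_max_of_le_right (by simpa using hm.2)
  · refine le_max_of_le_left ?_
    have hlt : τ ^ k * m < K := by
      by_contra! hK
      exact hrej k (Nat.lt_succ_self k) (hacc _ (by positivity) hK)
    calc τ ^ (k + 1) * m = τ * (τ ^ k * m) := by ring
      _ ≤ τ * K := by gcongr

end LineSearch

/-! ### Invariants of the algorithm -/

section Weights

variable {n : ℕ} {X : Set (Vec n)} {w : Vec n →₀ ℝ} {x : Vec n}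

/-- `w` is a system of convex weights on the vertices of `X` with barycentre `x`. -/
structure IsBarycentric (X : Set (Vec n)) (w : Vec n →₀ ℝ) (x : Vec n) : Prop where
  support_subset : (w.support : Set (Vec n)) ⊆ vertices X
  nonneg : ∀ v, 0 ≤ w v
  total : Finsupp.linearCombination ℝ (fun _ : Vec n => (1 : ℝ)) w = 1
  point : Finsupp.linearCombination ℝ id w = x

namespace IsBarycentric

theorem isProperCombination (h : IsBarycentric X w x) : IsProperCombination w.support x := by
  refine ⟨w, fun v hv => (h.nonneg v).lt_of_ne' (Finsupp.mem_support_iff.1 hv), ?_, ?_⟩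
  · simpa [Finsupp.linearCombination_apply, Finsupp.sum] using h.total
  · simpa [Finsupp.linearCombination_apply, Finsupp.sum] using h.point

theorem mem (h : IsBarycentric X w x) (hX : Convex ℝ X) : x ∈ X := by
  obtain ⟨c, hc, hc1, hcx⟩ := h.isProperCombination
  rw [← hcx]
  exact hX.sum_mem (fun v hv => (hc v hv).le) hc1 fun v hv =>
    extremePoints_subset (h.support_subset hv)

theorem single {v : Vec n} (hv : v ∈ vertices X) : IsBarycentric X (Finsupp.single v 1) v := by
  classical
  refine ⟨fun u hu => ?_, fun u => ?_, by simp, by simp⟩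
  · have := Finsupp.support_single_subset hu
    rwa [Finset.mem_singleton.1 this]
  · rw [Finsupp.single_apply]
    split_ifs <;> norm_num

theorem support_add_single [DecidableEq (Vec n)] (c γ : ℝ) (v : Vec n) :
    (c • w + Finsupp.single v γ).support ⊆ insert v w.support := by
  intro u hu
  by_contra hcon
  rw [Finset.mem_insert, not_or, Finsupp.notMem_support_iff] at hcon
  rw [Finsupp.mem_support_iff] at hu
  exact hu (by simp [hcon.2, Ne.symm hcon.1])

theorem toward (h : IsBarycentric X w x) {v : Vec n} (hv : v ∈ vertices X) {γ : ℝ} (h0 : 0 ≤ γ)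
    (h1 : γ ≤ 1) :
    IsBarycentric X ((1 - γ) • w + Finsupp.single v γ) (x + γ • (v - x)) := by
  classical
  refine ⟨fun u hu => ?_, fun u => ?_, ?_, ?_⟩
  · rcases Finset.mem_insert.1 (support_add_single _ _ _ hu) with rfl | hu
    · exact hv
    · exact h.support_subset hu
  · have h2 := mul_nonneg (sub_nonneg.2 h1) (h.nonneg u)
    have h3 : 0 ≤ Finsupp.single v γ u := by
      rw [Finsupp.single_apply]
      split_ifs <;> simp [h0]
    simpa using add_nonneg h2 h3
  · simp [h.total]
  · rw [map_add, map_smul, h.point, Finsupp.linearCombination_single, id]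
    module

theorem away (h : IsBarycentric X w x) {a : Vec n} (ha : a ∈ w.support) {γ : ℝ} (h0 : 0 ≤ γ)
    (ha1 : w a < 1) (h1 : γ ≤ w a / (1 - w a)) :
    IsBarycentric X ((1 + γ) • w - Finsupp.single a γ) (x + γ • (x - a)) := by
  classical
  have hsub : ((1 + γ) • w - Finsupp.single a γ).support ⊆ w.support := by
    rw [sub_eq_add_neg, ← Finsupp.single_neg]
    exact (support_add_single _ _ _).trans_eq (Finset.insert_eq_of_mem ha)
  refine ⟨fun u hu => h.support_subset (hsub hu), fun u => ?_, ?_, ?_⟩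
  -- The bound on `γ` is exactly nonnegativity of the new weight `(1 + γ) w a - γ`.
  · rw [le_div_iff₀ (sub_pos.2 ha1)] at h1
    have hu : 0 ≤ (1 + γ) * w u := mul_nonneg (by linarith) (h.nonneg u)
    rcases eq_or_ne a u with rfl | hau
    · simp
      linarith
    · simpa [Finsupp.single_apply, hau] using hu
  · simp [h.total]
  · rw [map_sub, map_smul, h.point, Finsupp.linearCombination_single, id]
    module

theorem card_away_le {a : Vec n} (ha : a ∈ w.support) (γ : ℝ) :
    ((1 + γ) • w - Finsupp.single a γ).support.card ≤ w.support.card := by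
  classical
  rw [sub_eq_add_neg, ← Finsupp.single_neg]
  exact Finset.card_le_card
    ((support_add_single _ _ _).trans_eq (Finset.insert_eq_of_mem ha))

/-- The maximal away step removes the away vertex from the active set. -/
theorem card_drop_lt {a : Vec n} (ha : a ∈ w.support) (ha1 : w a < 1) :
    ((1 + w a / (1 - w a)) • w - Finsupp.single a (w a / (1 - w a))).support.card + 1 ≤
      w.support.card := by
  classical
  rw [← Finset.card_erase_add_one ha]
  gcongr
  intro u hu
  have hu' : u ∈ w.support := by
    rw [sub_eq_add_neg, ← Finsupp.single_neg] at hu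
    exact ((support_add_single _ _ _).trans_eq (Finset.insert_eq_of_mem ha)) hu
  refine Finset.mem_erase.2 ⟨?_, hu'⟩
  rintro rfl
  refine Finsupp.mem_support_iff.1 hu ?_
  have : 1 - w u ≠ 0 := (sub_pos.2 ha1).ne'
  simp
  field_simp
  ring

theorem eq_of_one_le (h : IsBarycentric X w x) {a : Vec n} (ha : 1 ≤ w a) : x = a := by
  classical
  have haS : a ∈ w.support := Finsupp.mem_support_iff.2 (by linarith)
  have htot : ∑ v ∈ w.support, w v = 1 := by
    simpa [Finsupp.linearCombination_apply, Finsupp.sum] using h.total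
  rw [← Finset.add_sum_erase _ _ haS] at htot
  have hnn : ∀ v ∈ w.support.erase a, 0 ≤ w v := fun v _ => h.nonneg v
  have hz : ∑ v ∈ w.support.erase a, w v = 0 := le_antisymm (by linarith) (Finset.sum_nonneg hnn)
  have hw : w = Finsupp.single a 1 := by
    ext u
    rcases eq_or_ne a u with rfl | hau
    · simp
      linarith
    · rw [Finsupp.single_apply, if_neg hau]
      by_contra hu
      exact hu ((Finset.sum_eq_zero_iff_of_nonneg hnn).1 hz u
        (Finset.mem_erase.2 ⟨hau.symm, Finsupp.mem_support_iff.2 hu⟩))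
  rw [← h.point, hw]
  simp

end IsBarycentric

end Weights

/-! ### Geometric strong convexity and the contraction factor -/

section Convergence

variable {n : ℕ} {M ν : ℝ} {f : Vec n → WithTop ℝ} {X : Set (Vec n)} {x₀ xstar : Vec n}

theorem strongConst_nonneg (f : Vec n → WithTop ℝ) (C : Set (Vec n)) : 0 ≤ strongConst f C := by
  refine Real.sInf_nonneg ?_
  rintro _ ⟨u, -, d, -, rfl⟩
  positivity

theorem mem_initialLevel_of_isMinOn (hx₀ : x₀ ∈ X) (hx₀f : x₀ ∈ dom f) (hxstar : xstar ∈ X)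
    (hmin : IsMinOn f X xstar) : xstar ∈ initialLevel f X x₀ := by
  have h : f xstar ≤ f x₀ := hmin hx₀
  exact ⟨lt_of_le_of_lt h hx₀f, hxstar, h⟩

theorem primalGap_nonneg (hmin : IsMinOn f X xstar) (hxstar : xstar ∈ dom f) {x : Vec n}
    (hx : x ∈ X) (hxf : x ∈ dom f) : 0 ≤ primalGap f xstar x := by
  have h : f xstar ≤ f x := hmin hx
  rw [← coe_val hxstar, ← coe_val hxf, WithTop.coe_le_coe] at h
  exact sub_nonneg.2 h

namespace IsGenSelfConcordant

variable (hf : IsGenSelfConcordant M ν f)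
include hf

theorem primalGap_add_le (hX : IsPolytope X) (hx₀f : x₀ ∈ dom f) {x : Vec n}
    (hx : x ∈ initialLevel f X x₀) (hxs : xstar ∈ initialLevel f X x₀) :
    primalGap f xstar x + strongConst f (initialLevel f X x₀) / 2 * ‖xstar - x‖ ^ 2 ≤
      inner ℝ (grad f x) (x - xstar) := by
  have h := hf.add_strongConst_le (hf.isCompact_initialLevel hX hx₀f) (fun y hy => hy.1)
    (hf.convex_initialLevel hX hx₀f) hx hxs
  rw [← neg_sub x xstar, inner_neg_right, neg_sub] at h
  rw [primalGap]
  linarith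

/-- The Frank-Wolfe gap bounds the primal gap. -/
theorem primalGap_le (hX : IsPolytope X) (hx₀f : x₀ ∈ dom f) {x v : Vec n}
    (hx : x ∈ initialLevel f X x₀) (hxs : xstar ∈ initialLevel f X x₀)
    (hv : ∀ y ∈ X, inner ℝ (grad f x) v ≤ inner ℝ (grad f x) y) :
    primalGap f xstar x ≤ inner ℝ (grad f x) (x - v) := by
  have h1 := hf.primalGap_add_le hX hx₀f hx hxs
  have h2 := hv xstar hxs.2.1
  have h4 : 0 ≤ strongConst f (initialLevel f X x₀) / 2 * ‖xstar - x‖ ^ 2 :=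
    mul_nonneg (div_nonneg (strongConst_nonneg _ _) zero_le_two) (sq_nonneg _)
  rw [inner_sub_right] at h1 ⊢
  linarith

/-- The geometric strong convexity inequality. -/
theorem width_sq_mul_primalGap_le (hX : IsPolytope X) (hx₀f : x₀ ∈ dom f) {x v a : Vec n}
    {w : Vec n →₀ ℝ} (hx : x ∈ initialLevel f X x₀) (hxs : xstar ∈ initialLevel f X x₀)
    (hmin : IsMinOn f X xstar) (hw : IsBarycentric X w x)
    (hv : ∀ y ∈ X, inner ℝ (grad f x) v ≤ inner ℝ (grad f x) y)
    (ha : ∀ y ∈ w.support, inner ℝ (grad f x) y ≤ inner ℝ (grad f x) a)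
    {G : ℝ} (hG : inner ℝ (grad f x) (a - v) ≤ 2 * G) :
    pyramidalWidth X ^ 2 * strongConst f (initialLevel f X x₀) * primalGap f xstar x ≤
      2 * G ^ 2 := by
  have hgap := hf.primalGap_add_le hX hx₀f hx hxs
  set μ := strongConst f (initialLevel f X x₀)
  set h := primalGap f xstar x
  have hμ : 0 ≤ μ := strongConst_nonneg _ _
  have hh : 0 ≤ h := primalGap_nonneg hmin hxs.1 hx.2.1 hx.1
  rcases hh.eq_or_lt with h0 | hpos
  · rw [← h0, mul_zero]
    positivity
  set e := ‖xstar - x‖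
  set q := inner ℝ (grad f x) (x - xstar)
  have he0 : 0 ≤ e := norm_nonneg _
  have hμe : 0 ≤ μ / 2 * e ^ 2 := by positivity
  have hq : 0 < q := by linarith
  have hxne : xstar ≠ x := by
    rintro hxe
    simp [q, hxe] at hq
  have he : 0 < e := norm_pos_iff.2 (sub_ne_zero.2 hxne)
  have hqe : inner ℝ (-grad f x) (xstar - x) = q := by
    rw [inner_neg_left, ← inner_neg_right, neg_sub]
  have hwidth := hX.pyramidalWidth_mul_inner_le (r := -grad f x) (s := v) (a := a) hx.2.1 hxs.2.1
    hw.support_subset hw.isProperCombination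
    (fun z hz => by simpa only [inner_neg_left, neg_le_neg_iff] using hv z hz)
    (fun z hz => by simpa only [inner_neg_left, neg_le_neg_iff] using ha z hz) (hqe ▸ hq)
  rw [hqe, inner_neg_left, ← inner_neg_right, neg_sub] at hwidth
  have hδ : 0 < pyramidalWidth X := hX.pyramidalWidth_pos ⟨x, hx.2.1, xstar, hxs.2.1, hxne.symm⟩
  set δ := pyramidalWidth X
  have h1 : δ * q ≤ 2 * G * e := hwidth.trans (mul_le_mul_of_nonneg_right hG he0)
  have h2 : (δ * q) ^ 2 ≤ (2 * G * e) ^ 2 := by gcongr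
  -- AM-GM for the two terms of the strong convexity bound: `(h + μe²/2)² = (h - μe²/2)² + 2μhe²`.
  have h3 : 2 * μ * h * e ^ 2 ≤ q ^ 2 := by
    have : (h + μ / 2 * e ^ 2) ^ 2 ≤ q ^ 2 := by gcongr
    nlinarith [sq_nonneg (h - μ / 2 * e ^ 2)]
  have h4 : δ ^ 2 * (2 * μ * h * e ^ 2) ≤ δ ^ 2 * q ^ 2 := by gcongr
  have h5 : (δ ^ 2 * μ * h) * (2 * e ^ 2) ≤ (2 * G ^ 2) * (2 * e ^ 2) := by nlinarith
  exact le_of_mul_le_mul_right h5 (by positivity)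

end IsGenSelfConcordant

/-- An unrestricted step multiplies the primal gap by at most `1 - contraction f X x₀ B` if `B`
bounds the smoothness estimates. -/
noncomputable def contraction (f : Vec n → WithTop ℝ) (X : Set (Vec n)) (x₀ : Vec n) (B : ℝ) : ℝ :=
  strongConst f (initialLevel f X x₀) / (4 * B) * (pyramidalWidth X / Metric.diam X) ^ 2

theorem contraction_nonneg {B : ℝ} (hB : 0 < B) : 0 ≤ contraction f X x₀ B :=
  mul_nonneg (div_nonneg (strongConst_nonneg _ _) (by positivity)) (sq_nonneg _)

/-- The diameter is zero here, and division by zero gives zero. -/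
theorem contraction_of_subsingleton (hX : X.Subsingleton) (B : ℝ) : contraction f X x₀ B = 0 := by
  simp [contraction, Metric.diam_subsingleton hX]

theorem diam_pos_of_nontrivial (hX : IsPolytope X) (hne : X.Nontrivial) : 0 < Metric.diam X :=
  Metric.diam_pos hne hX.isCompact.isBounded

theorem IsGenSelfConcordant.contraction_le (hf : IsGenSelfConcordant M ν f) (hX : IsPolytope X)
    (hx₀f : x₀ ∈ dom f) (hx₀ : x₀ ∈ X) {B : ℝ} (hB : 0 < B)
    (hLB : smoothConst f (initialLevel f X x₀) ≤ B) : contraction f X x₀ B ≤ 1 / 4 := by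
  rcases X.subsingleton_or_nontrivial with hs | hne
  · rw [contraction_of_subsingleton hs]
    norm_num
  have hd : ∃ d : Vec n, d ≠ 0 := by
    obtain ⟨x, -, y, -, hxy⟩ := hne
    exact ⟨x - y, sub_ne_zero.2 hxy⟩
  obtain ⟨d, hd⟩ := hd
  have hμL := (hf.strongConst_le_smoothConst (hf.isCompact_initialLevel hX hx₀f)
    (fun y hy => hy.1) ⟨x₀, hx₀f, hx₀, le_rfl⟩ hd).trans hLB
  have hD := diam_pos_of_nontrivial hX hne
  have h1 : strongConst f (initialLevel f X x₀) / (4 * B) ≤ 1 / 4 := by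
    rw [div_le_div_iff₀ (by positivity) (by norm_num)]
    linarith
  have h2 : (pyramidalWidth X / Metric.diam X) ^ 2 ≤ 1 :=
    pow_le_one₀ (div_nonneg (hX.pyramidalWidth_pos hne).le hD.le)
      ((div_le_one hD).2 (hX.pyramidalWidth_le_diam hne))
  calc contraction f X x₀ B ≤ 1 / 4 * 1 := mul_le_mul h1 h2 (sq_nonneg _) (by norm_num)
    _ = 1 / 4 := mul_one _

/-- The decrease guaranteed by an unrestricted step. -/
theorem contraction_mul_le {B m G h N : ℝ} (hX : IsPolytope X) (hm : 0 < m) (hmB : m ≤ B)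
    (hG : 0 ≤ G) (hN0 : 0 ≤ N) (hN : N ≤ Metric.diam X) (hN' : N = 0 → G = 0)
    (hwidth : pyramidalWidth X ^ 2 * strongConst f (initialLevel f X x₀) * h ≤ 2 * G ^ 2) :
    contraction f X x₀ B * h ≤ G / (m * N ^ 2) * G / 2 := by
  have hB : 0 < B := hm.trans_le hmB
  rcases X.subsingleton_or_nontrivial with hs | hne
  · rw [contraction_of_subsingleton hs, zero_mul]
    positivity
  have hD := diam_pos_of_nontrivial hX hne
  have hc : contraction f X x₀ B * h =
      pyramidalWidth X ^ 2 * strongConst f (initialLevel f X x₀) * h /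
        (4 * B * Metric.diam X ^ 2) := by
    rw [contraction]
    field_simp
  rw [hc]
  -- For `N = 0` the right side is zero by the division convention; then `G = 0` makes the left side
  -- nonpositive.
  rcases hN0.eq_or_lt with h0 | hNpos
  · have hG0 := hN' h0.symm
    rw [hG0] at hwidth ⊢
    have : pyramidalWidth X ^ 2 * strongConst f (initialLevel f X x₀) * h /
        (4 * B * Metric.diam X ^ 2) ≤ 0 :=
      div_nonpos_of_nonpos_of_nonneg (by linarith) (by positivity)
    simpa using this
  · calc _ ≤ 2 * G ^ 2 / (4 * B * Metric.diam X ^ 2) := by gcongr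
      _ ≤ 2 * G ^ 2 / (4 * m * N ^ 2) := by gcongr
      _ = _ := by
        field_simp
        ring

/-! ### Iterations -/

/-- The properties of the states of the algorithm that each iteration preserves. -/
structure IsAdmissible (f : Vec n → WithTop ℝ) (X : Set (Vec n)) (x₀ : Vec n) (B : ℝ)
    (s : State n) : Prop where
  mem : s.point ∈ initialLevel f X x₀
  bary : IsBarycentric X s.weights s.point
  estimate_pos : 0 < s.estimate
  estimate_le : s.estimate ≤ B

/-- Weight one forces the iterate to equal `a`, so the away gap vanishes and cannot exceed the
nonnegative Frank-Wolfe gap. The maximal away step therefore has a positive denominator. -/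
theorem IsAdmissible.away_lt_one {B : ℝ} {s : State n} (hs : IsAdmissible f X x₀ B s) {v a : Vec n}
    (hv : ∀ y ∈ X, inner ℝ (grad f s.point) v ≤ inner ℝ (grad f s.point) y)
    (hlt : inner ℝ (grad f s.point) (s.point - v) < inner ℝ (grad f s.point) (a - s.point)) :
    s.weights a < 1 := by
  by_contra! h1
  rw [← hs.bary.eq_of_one_le h1, sub_self, inner_zero_right, inner_sub_right] at hlt
  linarith [hv _ hs.mem.2.1]

theorem away_point_mem {B : ℝ} (hX : IsPolytope X) {s : State n} (hs : IsAdmissible f X x₀ B s)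
    {a : Vec n} (ha : a ∈ s.weights.support) (ha1 : s.weights a < 1) :
    0 ≤ s.weights a / (1 - s.weights a) ∧
      s.point + (s.weights a / (1 - s.weights a)) • (s.point - a) ∈ X := by
  have h0 : 0 ≤ s.weights a / (1 - s.weights a) :=
    div_nonneg (hs.bary.nonneg a) (sub_pos.2 ha1).le
  exact ⟨h0, (hs.bary.away ha h0 ha1 le_rfl).mem hX.convex⟩

namespace IsGenSelfConcordant

variable (hf : IsGenSelfConcordant M ν f)
include hf

/-- From every admissible state a further iteration is possible. -/
theorem exists_step (hX : IsPolytope X) (hx₀f : x₀ ∈ dom f) {τ B : ℝ} (hτ : 1 < τ) {s : State n}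
    (hs : IsAdmissible f X x₀ B s) : ∃ s', Step τ f X s s' := by
  set g := grad f s.point with hg
  have hVne : hX.finite_vertices.toFinset.Nonempty := by
    obtain ⟨v, hv⟩ := hs.bary.isProperCombination.nonempty
    exact ⟨v, hX.finite_vertices.mem_toFinset.2 (hs.bary.support_subset hv)⟩
  obtain ⟨v, hvV, hvmin⟩ := Finset.exists_min_image _ (fun v => inner ℝ g v) hVne
  rw [hX.finite_vertices.mem_toFinset] at hvV
  have hv : ∀ y ∈ X, inner ℝ g v ≤ inner ℝ g y := by
    have hconv : Convex ℝ {y : Vec n | inner ℝ g v ≤ inner ℝ g y} :=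
      convex_halfSpace_ge (innerₗ (Vec n) g).isLinear _
    have hsub : vertices X ⊆ {y : Vec n | inner ℝ g v ≤ inner ℝ g y} := fun u hu =>
      hvmin u (hX.finite_vertices.mem_toFinset.2 hu)
    intro y hy
    rw [← hX.convexHull_vertices] at hy
    exact convexHull_min hsub hconv hy
  obtain ⟨a, ha, hamax⟩ := Finset.exists_max_image _ (fun v => inner ℝ g v)
    hs.bary.isProperCombination.nonempty
  have hxv : 0 ≤ inner ℝ g (s.point - v) := by
    rw [inner_sub_right]
    linarith [hv _ hs.mem.2.1]
  rcases le_or_gt (inner ℝ g (a - s.point)) (inner ℝ g (s.point - v)) with hle | hlt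
  · obtain ⟨γ, L', hbt⟩ := exists_isBacktrack (γmax := 1) hτ hs.estimate_pos fun m hm hLm =>
      hf.accepts_of_smoothConst_le hX hx₀f hs.mem (d := v - s.point)
        (by rw [← neg_sub, inner_neg_right]; linarith) zero_le_one
        (by simpa using extremePoints_subset hvV) hm hLm
    exact ⟨⟨_, _, L'⟩, v, a, γ, hvV, hv, ha, hamax, Or.inl ⟨hle, hbt, rfl, rfl⟩⟩
  · obtain ⟨h0, hmem⟩ := away_point_mem hX hs ha (hs.away_lt_one hv hlt)
    obtain ⟨γ, L', hbt⟩ := exists_isBacktrack hτ hs.estimate_pos fun m hm hLm =>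
      hf.accepts_of_smoothConst_le hX hx₀f hs.mem (d := s.point - a)
        (by rw [← neg_sub, inner_neg_right]; linarith) h0 hmem hm hLm
    exact ⟨⟨_, _, L'⟩, v, a, γ, hvV, hv, ha, hamax, Or.inr ⟨hlt, hbt, rfl, rfl⟩⟩

/-- An iteration preserves admissibility, and either contracts the primal gap while adding at most
one vertex to the active set, or does not increase the gap while removing a vertex. -/
theorem step_progress (hX : IsPolytope X) (hx₀f : x₀ ∈ dom f) (hx₀ : x₀ ∈ X)
    (hxstar : xstar ∈ X) (hmin : IsMinOn f X xstar) {τ B : ℝ} (hτ : 1 < τ)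
    (hL : 0 ≤ smoothConst f (initialLevel f X x₀))
    (hLB : τ * smoothConst f (initialLevel f X x₀) ≤ B) {s s' : State n}
    (hs : IsAdmissible f X x₀ B s) (hstep : Step τ f X s s') :
    IsAdmissible f X x₀ B s' ∧
      ((primalGap f xstar s'.point ≤ (1 - contraction f X x₀ B) * primalGap f xstar s.point ∧
          s'.weights.support.card ≤ s.weights.support.card + 1) ∨
        (primalGap f xstar s'.point ≤ primalGap f xstar s.point ∧
          s'.weights.support.card + 1 ≤ s.weights.support.card)) := by
  classical
  obtain ⟨v, a, γ, hvV, hv, ha, hamax, hcases⟩ := hstep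
  have hxs := mem_initialLevel_of_isMinOn hx₀ hx₀f hxstar hmin
  have hB : 0 < B := hs.estimate_pos.trans_le hs.estimate_le
  have hLB' : smoothConst f (initialLevel f X x₀) ≤ B :=
    (le_mul_of_one_le_left hL hτ.le).trans hLB
  have hρ := hf.contraction_le hX hx₀f hx₀ hB hLB'
  have hh : 0 ≤ primalGap f xstar s.point := primalGap_nonneg hmin hxs.1 hs.mem.2.1 hs.mem.1
  have hFW := hf.primalGap_le hX hx₀f hs.mem hxs hv
  have hwidth := fun G hG => hf.width_sq_mul_primalGap_le hX hx₀f hs.mem hxs hmin hs.bary hv hamax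
    (G := G) hG
  have hsv := ((mem_initialLevel hx₀f).1 hs.mem).2.2
  have hdiam : ∀ {y z : Vec n}, y ∈ X → z ∈ X → ‖y - z‖ ≤ Metric.diam X := fun hy hz => by
    rw [← dist_eq_norm]
    exact Metric.dist_le_diam_of_mem hX.isCompact.isBounded hy hz
  have hsplit : inner ℝ (grad f s.point) (a - v) =
      inner ℝ (grad f s.point) (a - s.point) + inner ℝ (grad f s.point) (s.point - v) := by
    rw [← inner_add_right, sub_add_sub_cancel]
  have hvX : v ∈ X := extremePoints_subset hvV
  have haX : a ∈ X := extremePoints_subset (hs.bary.support_subset ha)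
  -- Both directions are treated alike: the chosen one has the larger gap, so twice its gap
  -- dominates `⟨∇f(x), a - v⟩`. Only a step at `γmax` escapes the contraction estimate.
  have key : ∀ (d : Vec n) (γmax : ℝ), 0 ≤ γmax → s.point + γmax • d ∈ X →
      0 ≤ -inner ℝ (grad f s.point) d →
      inner ℝ (grad f s.point) (a - v) ≤ 2 * -inner ℝ (grad f s.point) d →
      ‖d‖ ≤ Metric.diam X → IsBacktrack τ f s.point d s.estimate γmax γ s'.estimate →
      0 < s'.estimate ∧ s'.estimate ≤ B ∧ 0 ≤ γ ∧ γ ≤ γmax ∧ s.point + γ • d ∈ dom f ∧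
      val f (s.point + γ • d) ≤ val f s.point - γ * -inner ℝ (grad f s.point) d / 2 ∧
      (γ ≠ γmax → primalGap f xstar (s.point + γ • d) ≤
        (1 - contraction f X x₀ B) * primalGap f xstar s.point) := by
    intro d γmax hγ0 hγX hG hG2 hdD hbt
    obtain ⟨hpos, hle, hacc, hγ⟩ := hbt.bounds hτ hs.estimate_pos fun m hm hLm =>
      hf.accepts_of_smoothConst_le hX hx₀f hs.mem (by linarith) hγ0 hγX hm hLm
    have hval := hacc.val_le (by linarith) hγ0 hpos
    have hB' : s'.estimate ≤ B := hle.trans (max_le hLB hs.estimate_le)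
    rw [← hγ] at hval
    refine ⟨hpos, hB', hγ ▸ trialStep_nonneg (by linarith) hγ0 hpos,
      hγ ▸ trialStep_le _ _ _ _ _, hγ ▸ hacc.1, by linarith, fun hne => ?_⟩
    have hγe : γ = -inner ℝ (grad f s.point) d / (s'.estimate * ‖d‖ ^ 2) := by
      rw [hγ, trialStep]
      refine min_eq_left (le_of_not_ge fun hge => hne ?_)
      rw [hγ, trialStep, min_eq_right hge]
    have hc := contraction_mul_le (f := f) (x₀ := x₀) hX hpos hB' hG (norm_nonneg d) hdD
      (fun h => by simp [norm_eq_zero.1 h]) (hwidth _ hG2)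
    rw [← hγe] at hc
    simp only [primalGap] at hc ⊢
    linarith
  have hxv : 0 ≤ inner ℝ (grad f s.point) (s.point - v) := hh.trans hFW
  rcases hcases with ⟨hle, hbt, hpt, hw⟩ | ⟨hlt, hbt, hpt, hw⟩
  · have hneg : -inner ℝ (grad f s.point) (v - s.point) =
        inner ℝ (grad f s.point) (s.point - v) := by
      rw [← inner_neg_right, neg_sub]
    obtain ⟨hpos, hB', hγ0, hγ1, hdom, hval, hgood⟩ := key _ 1 zero_le_one (by simpa using hvX)
      (by rw [hneg]; exact hxv) (by rw [hneg]; linarith) (hdiam hvX hs.mem.2.1) hbt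
    rw [← hpt] at hdom hval hgood
    have hbary : IsBarycentric X s'.weights s'.point := by
      rw [hw, hpt]
      exact hs.bary.toward hvV hγ0 hγ1
    rw [hneg] at hval
    have hγG := mul_nonneg hγ0 hxv
    refine ⟨⟨(mem_initialLevel hx₀f).2 ⟨hdom, hbary.mem hX.convex, by linarith⟩, hbary, hpos, hB'⟩,
      Or.inl ⟨?_, ?_⟩⟩
    -- A full Frank-Wolfe step gains half the Frank-Wolfe gap, hence at least half the primal gap; a
    -- quarter would do.
    · by_cases hγ : γ = 1
      · rw [hγ, one_mul] at hval
        have hρh : contraction f X x₀ B * primalGap f xstar s.point ≤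
          1 / 4 * primalGap f xstar s.point := mul_le_mul_of_nonneg_right hρ hh
        simp only [primalGap] at hFW hρh hh ⊢
        linarith
      · exact hgood hγ
    · rw [hw]
      exact (Finset.card_le_card (IsBarycentric.support_add_single _ _ _)).trans
        (Finset.card_insert_le _ _)
  · have ha1 := hs.away_lt_one hv hlt
    obtain ⟨h0, hmem⟩ := away_point_mem hX hs ha ha1
    have hneg : -inner ℝ (grad f s.point) (s.point - a) =
        inner ℝ (grad f s.point) (a - s.point) := by
      rw [← inner_neg_right, neg_sub]
    obtain ⟨hpos, hB', hγ0, hγ1, hdom, hval, hgood⟩ := key _ _ h0 hmem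
      (by rw [hneg]; linarith) (by rw [hneg]; linarith) (hdiam hs.mem.2.1 haX) hbt
    rw [← hpt] at hdom hval hgood
    have hbary : IsBarycentric X s'.weights s'.point := by
      rw [hw, hpt]
      exact hs.bary.away ha hγ0 ha1 hγ1
    rw [hneg] at hval
    have hγG := mul_nonneg hγ0 (hxv.trans hlt.le)
    refine ⟨⟨(mem_initialLevel hx₀f).2 ⟨hdom, hbary.mem hX.convex, by linarith⟩, hbary, hpos, hB'⟩,
      ?_⟩
    by_cases hγ : γ = s.weights a / (1 - s.weights a)
    · refine Or.inr ⟨?_, ?_⟩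
      · simp only [primalGap]
        linarith
      · rw [hw, hγ]
        exact IsBarycentric.card_drop_lt ha ha1
    · refine Or.inl ⟨hgood hγ, ?_⟩
      rw [hw]
      exact (IsBarycentric.card_away_le ha γ).trans (Nat.le_succ _)

/-- The states of a run are admissible, and the primal gap has been contracted in at least half of
the iterations. -/
theorem run_progress (hX : IsPolytope X) (hx₀f : x₀ ∈ dom f) (hx₀ : x₀ ∈ vertices X)
    (hxstar : xstar ∈ X) (hmin : IsMinOn f X xstar) {τ B Linit : ℝ} (hτ : 1 < τ)
    (hL : 0 ≤ smoothConst f (initialLevel f X x₀))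
    (hLB : τ * smoothConst f (initialLevel f X x₀) ≤ B) (hLinit : 0 < Linit) (hB : Linit ≤ B)
    {t : ℕ} {s : ℕ → State n} (hrun : IsRun τ f X x₀ Linit t s) :
    IsAdmissible f X x₀ B (s t) ∧ ∃ k : ℕ,
      primalGap f xstar (s t).point ≤
        primalGap f xstar x₀ * (1 - contraction f X x₀ B) ^ k ∧
      -- Each side starts at one. A contracting step adds at most two to the left and two to the
      -- right; a drop step adds nothing to the right and its lost vertex offsets the iteration
      -- count.
      (s t).weights.support.card + t ≤ 2 * k + 1 := by
  have hx₀X : x₀ ∈ X := extremePoints_subset hx₀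
  have hρ : 0 ≤ 1 - contraction f X x₀ B := by
    have := hf.contraction_le hX hx₀f hx₀X (hLinit.trans_le hB)
      ((le_mul_of_one_le_left hL hτ.le).trans hLB)
    linarith
  induction t with
  | zero =>
    rw [hrun.1]
    refine ⟨⟨⟨hx₀f, hx₀X, le_rfl⟩, IsBarycentric.single hx₀, hLinit, hB⟩, 0, ?_, ?_⟩
    · simp [initialState]
    · simp [initialState]
  | succ t ih =>
    obtain ⟨hadm, k, hk, hcard⟩ := ih ⟨hrun.1, fun i hi => hrun.2 i (by omega)⟩
    obtain ⟨hadm', hprog⟩ := hf.step_progress hX hx₀f hx₀X hxstar hmin hτ hL hLB hadm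
      (hrun.2 t (Nat.lt_succ_self t))
    refine ⟨hadm', ?_⟩
    rcases hprog with ⟨hgap, hc⟩ | ⟨hgap, hc⟩
    · refine ⟨k + 1, hgap.trans ?_, by omega⟩
      calc _ ≤ (1 - contraction f X x₀ B) *
            (primalGap f xstar x₀ * (1 - contraction f X x₀ B) ^ k) := by gcongr
        _ = _ := by ring
    · exact ⟨k, hgap.trans hk, by omega⟩

end IsGenSelfConcordant

end Convergence

end AwayFW

/-! ### The convergence theorem -/

theorem mainTheorem3 {n : ℕ} (M ν : ℝ) (hν : 2 ≤ ν)
    (f : AwayFW.Vec n → WithTop ℝ) (hf : AwayFW.IsGenSelfConcordant M ν f)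
    (hline : AwayFW.ContainsNoLine (AwayFW.dom f))
    (X : Set (AwayFW.Vec n)) (hX : AwayFW.IsPolytope X)
    (x₀ : AwayFW.Vec n) (hx₀ : x₀ ∈ AwayFW.vertices X) (hx₀f : x₀ ∈ AwayFW.dom f)
    (xstar : AwayFW.Vec n) (hxstar : xstar ∈ X) (hmin : IsMinOn f X xstar)
    (τ : ℝ) (hτ : 1 < τ) (Linit : ℝ) (hLinit : 0 < Linit)
    (μ L δ D Ltilde : ℝ)
    (hμ : μ = AwayFW.strongConst f (AwayFW.initialLevel f X x₀))
    (hL : L = AwayFW.smoothConst f (AwayFW.initialLevel f X x₀))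
    (hδ : δ = AwayFW.pyramidalWidth X) (hD : D = Metric.diam X)
    (hLtilde : Ltilde = max (τ * L) Linit) :
    (X.Nontrivial → 0 < μ ∧ 0 < δ) ∧
      ∀ (t : ℕ) (s : ℕ → AwayFW.State n), AwayFW.IsRun τ f X x₀ Linit t s →
        (s t).point ∈ X ∩ AwayFW.dom f ∧
        AwayFW.primalGap f xstar (s t).point ≤
          AwayFW.primalGap f xstar x₀ *
            (1 - μ / (4 * Ltilde) * (δ / D) ^ 2) ^ ⌈((t : ℝ) - 1) / 2⌉₊ ∧
        ∃ s' : AwayFW.State n, AwayFW.Step τ f X (s t) s' := by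
  have hx₀X : x₀ ∈ X := extremePoints_subset hx₀
  have hxs := AwayFW.mem_initialLevel_of_isMinOn hx₀X hx₀f hxstar hmin
  have hL0 : 0 ≤ AwayFW.smoothConst f (AwayFW.initialLevel f X x₀) := by
    refine Real.sSup_nonneg ?_
    rintro _ ⟨u, -, d, -, rfl⟩
    positivity
  have hLB : τ * AwayFW.smoothConst f (AwayFW.initialLevel f X x₀) ≤ Ltilde := by
    rw [hLtilde, hL]
    exact le_max_left _ _
  have hB : Linit ≤ Ltilde := hLtilde ▸ le_max_right _ _
  refine ⟨fun hne => ⟨?_, hδ ▸ hX.pyramidalWidth_pos hne⟩, fun t s hrun => ?_⟩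
  · obtain ⟨x, -, y, -, hxy⟩ := hne
    rw [hμ]
    exact hf.strongConst_pos hν hline (hf.isCompact_initialLevel hX hx₀f) (fun y hy => hy.1)
      ⟨xstar, hxs⟩ (sub_ne_zero.2 hxy)
  obtain ⟨hadm, k, hk, hcard⟩ := hf.run_progress hX hx₀f hx₀ hxstar hmin hτ hL0 hLB hLinit hB hrun
  refine ⟨⟨hadm.mem.2.1, hadm.mem.1⟩, hk.trans ?_, hf.exists_step hX hx₀f hτ hadm⟩
  have hρ : μ / (4 * Ltilde) * (δ / D) ^ 2 = AwayFW.contraction f X x₀ Ltilde := by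
    rw [AwayFW.contraction, hμ, hδ, hD]
  have h0 := AwayFW.contraction_nonneg (f := f) (X := X) (x₀ := x₀) (hLinit.trans_le hB)
  have h1 := hf.contraction_le hX hx₀f hx₀X (hLinit.trans_le hB)
    ((le_mul_of_one_le_left hL0 hτ.le).trans hLB)
  rw [hρ]
  refine mul_le_mul_of_nonneg_left (pow_le_pow_of_le_one (by linarith) (by linarith) ?_)
    (AwayFW.primalGap_nonneg hmin hxs.1 hx₀X hx₀f)
  -- The active set is never empty, so the count gives `t ≤ 2 * k`, slightly more than the stated
  -- exponent requires.
  have hpos : 1 ≤ (s t).weights.support.card :=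
    Finset.card_pos.2 hadm.bary.isProperCombination.nonempty
  have htk : (t : ℝ) ≤ 2 * k := by exact_mod_cast (by omega : t ≤ 2 * k)
  rw [Nat.ceil_le]
  linarith
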